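/- Let $\mathbb T^b$ be the infinite rooted $b$-ary tree with root $r$ (every vertex has $b$ children), let $C\ge 2$ be even, and consider the multi-state hard core model with activity $\lambda>0$: the spins take values in $\{0,\dots,C\}$, a configuration is allowed if $\sigma_x+\sigma_y\le C$ for every edge $xy$, and for a finite vertex set $U$ and a boundary condition $\tau$ the finite-volume measure $\mu^\tau_{U}$ gives each allowed configuration on $U$ a probability proportional to $\prod_{v\in U}\lambda^{\sigma_v}$. A Gibbs measure is a probability measure on $\{0,\dots,C\}^{\mathbb T^b}$ whose conditional law in every finite $U$, given the spins outside $U$, is this finite-volume measure; there is *phase coexistence* at $\lambda$ if there are at least two Gibbs measures, *uniqueness* if there is exactly one. Let $T_n$ be the set of vertices at distance at most $n$ from $r$, let $\mu^0_{T_n},\mu^C_{T_n}$ be the measures with boundary condition identically $0$ and identically $C$, and put $$m(\lambda)=\limsup_{n\to\infty}\bigl[\mu^C_{T_n}(\sigma_r>C/2)-\mu^0_{T_n}(\sigma_r>C/2)\bigr].$$ Let $\delta_\lambda$ be the total variation distance between the limits, along trees whose boundary is at even distance from $r$, of the laws of $\sigma_r$ under $\mu^0_{T_n}$ and under $\mu^C_{T_n}$.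 A *phase transition* occurs at $\lambda_{cr}>0$ if there is uniqueness for all $0<\lambda<\lambda_{cr}$ and phase coexistence for all $\lambda>\lambda_{cr}$; it is *first-order* if $\lambda\mapsto\delta_\lambda$ is discontinuous at $\lambda_{cr}$. For every even $C\ge2$ there are constants $c_1,c_2,\alpha>0$ and $b_0$, depending only on $C$, such that the following holds for all $b\ge b_0$. 1. For every $\lambda>0$ the limits in the definition of $\delta_\lambda$ exist. 2. For all $0<\lambda\le\left(\frac{3\log b}{b}\right)^{2/(C+2)}$ (in particular for all $\lambda\in\left[\left(\frac{\log b}{b}\right)^{2/(C+2)},\left(\frac{3\log b}{b}\right)^{2/(C+2)}\right]$) and all $0<\delta<1$, either $m(\lambda)=0$ or $m(\lambda)\ge \frac{\delta}{b}-c_1e^{-c_2b^\alpha}$. 3. There is $\lambda_c$ with $\left(\frac{\log b}{(C+2)\,b}\right)^{2/(C+2)}\le\lambda_c\le\left(\frac{\log b}{b}\right)^{2/(C+2)}$ such that there is uniqueness for every $0<\lambda<\lambda_c$, $\lambda_c$ is the infimum of the set of $\lambda>0$ with phase coexistence, and both $m(\lambda)$ and $\delta_\lambda$ are discontinuous at $\lambda=\lambda_c$.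 4. If a phase transition occurs at some $\lambda_{cr}$, then it is first-order. -/

import Mathlib

open MeasureTheory Filter Topology

noncomputable section

namespace MultiStateHardCore

/-- The infinite rooted `b`-ary tree: vertices are finite words over `Fin b`, the root is the empty
word, and the children of `x` are the `b` words `a :: x`. The distance of `x` to the root is its
length. -/
def tree (b : ℕ) : SimpleGraph (List (Fin b)) where
  Adj x y := (∃ a, y = a :: x) ∨ (∃ a, x = a :: y)
  symm := ⟨fun _ _ h => h.symm⟩
  loopless := ⟨fun x h => by
    rcases h with ⟨a, h⟩ | ⟨a, h⟩ <;> simpa using congrArg List.length h⟩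

/-- Spin configurations on the tree, with states `0, …, C`. -/
abbrev Config (C b : ℕ) : Type := List (Fin b) → Fin (C + 1)

/-- The configuration equal to `η` on the finite set `U` and to `τ` off `U`. -/
def glue {C b : ℕ} (U : Finset (List (Fin b))) (τ : Config C b) (η : U → Fin (C + 1)) :
    Config C b :=
  fun v => if h : v ∈ U then η ⟨v, h⟩ else τ v

/-- The hard constraint on all edges with at least one endpoint in `U`. -/
def FeasibleOn {C b : ℕ} (U : Finset (List (Fin b))) (σ : Config C b) : Prop :=
  ∀ x ∈ U, ∀ y, (tree b).Adj x y → (σ x : ℕ) + (σ y : ℕ) ≤ C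

open Classical in
/-- Unnormalised weight `∏_{v ∈ U} lam ^ η_v` of a configuration `η` on `U` that is allowed given the
boundary condition `τ`; it is `0` if `η` is not allowed. -/
def weight (C b : ℕ) (lam : ℝ) (U : Finset (List (Fin b))) (τ : Config C b)
    (η : U → Fin (C + 1)) : ℝ :=
  if FeasibleOn U (glue U τ η) then ∏ v : U, lam ^ (η v : ℕ) else 0

/-- The partition function on `U` with boundary condition `τ` (for `lam > 0` it is at least `1`,
because `η = 0` is always allowed). -/
def partitionFn (C b : ℕ) (lam : ℝ) (U : Finset (List (Fin b))) (τ : Config C b) : ℝ :=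
  ∑ η : U → Fin (C + 1), weight C b lam U τ η

/-- The probability of `η` under the finite-volume measure on `U` with boundary condition `τ`
(only the values of `τ` on the boundary of `U` matter). -/
def finVolProb (C b : ℕ) (lam : ℝ) (U : Finset (List (Fin b))) (τ : Config C b)
    (η : U → Fin (C + 1)) : ℝ :=
  weight C b lam U τ η / partitionFn C b lam U τ

/-- The finite tree `T_n` of all vertices at distance at most `n` from the root; its boundary is
the set of vertices at distance `n + 1`. -/
def ball (b n : ℕ) : Finset (List (Fin b)) :=
  (List.finite_length_le (Fin b) n).toFinset

open Classical in
/-- `μ^a_{T_n}(A)`: the probability of the event `A` under the measure on `T_n` with boundary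
condition identically `a`. -/
def ballProb (C b : ℕ) (lam : ℝ) (n : ℕ) (a : Fin (C + 1)) (A : Set (Config C b)) : ℝ :=
  ∑ η : ball b n → Fin (C + 1),
    if glue (ball b n) (fun _ => a) η ∈ A then finVolProb C b lam (ball b n) (fun _ => a) η else 0

/-- `m(lam) = limsup_n [μ^C_{T_n}(σ_r > C/2) - μ^0_{T_n}(σ_r > C/2)]` for even `C`. -/
def m (C b : ℕ) (lam : ℝ) : ℝ :=
  limsup (fun n : ℕ =>
    ballProb C b lam n (Fin.last C) {σ | C / 2 < (σ [] : ℕ)}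
      - ballProb C b lam n 0 {σ | C / 2 < (σ [] : ℕ)}) atTop

/-- The sigma-field generated by the spins outside `U`. -/
@[reducible] def outside (C b : ℕ) (U : Finset (List (Fin b))) : MeasurableSpace (Config C b) :=
  ⨆ v : {v // v ∉ U}, MeasurableSpace.comap (fun σ : Config C b => σ v) ⊤

/-- Gibbs measures of activity `lam`: probability measures whose conditional law in every finite
`U`, given the spins outside `U`, is the finite-volume measure on `U` with that boundary
condition. -/
structure IsGibbs (C b : ℕ) (lam : ℝ) (μ : Measure (Config C b)) : Prop where
  isProbabilityMeasure : IsProbabilityMeasure μ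
  condExp_eq : ∀ (U : Finset (List (Fin b))) (η : U → Fin (C + 1)),
    μ[Set.indicator {σ : Config C b | ∀ v : U, σ v = η v} (fun _ => (1 : ℝ)) | outside C b U]
      =ᵐ[μ] fun τ => finVolProb C b lam U τ η

/-- There is exactly one Gibbs measure. -/
def GibbsUnique (C b : ℕ) (lam : ℝ) : Prop := ∃! μ : Measure (Config C b), IsGibbs C b lam μ

/-- There are several Gibbs measures. -/
def PhaseCoexistence (C b : ℕ) (lam : ℝ) : Prop :=
  ∃ μ ν : Measure (Config C b), IsGibbs C b lam μ ∧ IsGibbs C b lam ν ∧ μ ≠ ν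

/-- Law of the root spin under the finite-volume measure on `T_{2n+1}` with constant boundary
condition `a`; the boundary is at the even distance `2n + 2` from the root. -/
def rootLaw (C b : ℕ) (lam : ℝ) (a : Fin (C + 1)) (n : ℕ) (i : Fin (C + 1)) : ℝ :=
  ballProb C b lam (2 * n + 1) a {σ | σ [] = i}

/-- Law of the root spin under the infinite-volume limit of these measures: the empty boundary
condition Gibbs measure for `a = 0` and the full one for `a = C`. -/
def limitRootLaw (C b : ℕ) (lam : ℝ) (a : Fin (C + 1)) (i : Fin (C + 1)) : ℝ :=
  limUnder atTop (fun n : ℕ => rootLaw C b lam a n i)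

/-- `δ_lam`: total variation distance of the root marginals of the empty and the full boundary
condition Gibbs measures. -/
def rootGap (C b : ℕ) (lam : ℝ) : ℝ :=
  (1 / 2) * ∑ i : Fin (C + 1), |limitRootLaw C b lam (Fin.last C) i - limitRootLaw C b lam 0 i|

/-- A phase transition occurs at `lc`: uniqueness below and coexistence above. -/
def IsPhaseTransitionAt (C b : ℕ) (lc : ℝ) : Prop :=
  0 < lc ∧ (∀ lam, 0 < lam → lam < lc → GibbsUnique C b lam) ∧
    ∀ lam, lc < lam → PhaseCoexistence C b lam

/-- A first-order phase transition: `δ_lam` is discontinuous at the transition point. -/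
def IsFirstOrderAt (C b : ℕ) (lc : ℝ) : Prop :=
  IsPhaseTransitionAt C b lc ∧ ¬ ContinuousAt (rootGap C b) lc

end MultiStateHardCore

end

/-! Root laws of finite trees are iterates of `homStep`, which sends a law `q` to the normalisation
of `lam ^ i * compat q i ^ b`. An empty boundary corresponds to the point mass at `0`; a full
boundary gives the same iterates one step later, because one step turns the point mass at `C` into
the one at `0`. The hard constraint makes the step order reversing for `Below`, and the point mass
at `0` is the least law. So the even iterates increase to a law `p`, the odd ones decrease to a law
`p'` above `p`, and `homStep` exchanges `p` and `p'`. Any boundary condition is squeezed between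
these iterates, so `p = p'` gives uniqueness (`gibbsUnique_of_eq`); if `p ≠ p'`, Markov chains that
alternate `p` and `p'` along the generations are two Gibbs measures (`phaseCoexistence_of_ne`).

With `C = 2 * k`, what remains concerns the gap `compat p k - compat p' k`, the difference of the
masses above `k`, which bounds `m` and, up to a factor two, `rootGap` from below. The core is the
dichotomy `IsExtremalPair.eq_or_lt_gap`. If `p'` has mass at most `1 / b` above `k`, then with
non-negligible probability all `b` children of a vertex stay at or below `k`. Under `p` each spin up
to `k` then keeps enough mass for a vertex to have many children blocking the large spins, the
recursion contracts (`IsExtremalPair.eq_of_contraction`), and `p = p'`. Otherwise `p'` has mass more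
than `1 / b` above `k`, while the mass of `p` there is exponentially small in a power of `b`. A
nonzero gap is therefore nearly `1 / b` or more. Activities with `b * lam ^ (k + 1)` below a
constant are treated separately and always contract.

The same contraction gives uniqueness up to the lower end of the window
(`IsExtremalPair.eq_of_lt_window`). At the upper end `p'` keeps mass of order `log b / b` above `k`
(`IsExtremalPair.ne_of_log_eq`), so there is coexistence. The infimum of the coexistence set thus
lies in the window; the gap vanishes below it and is at least `1 / (2 * b)` at coexistence points
arbitrarily near it, which is the jump. Monotonicity of coexistence in `lam` is never needed. -/

namespace MultiStateHardCore

variable {C b : ℕ}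

/-! ### The tree recursion on laws of a single spin -/

/-- The mass that `q` gives to the spins allowed next to a vertex in state `i`. -/
noncomputable def compat (q : Fin (C + 1) → ℝ) (i : ℕ) : ℝ :=
  ∑ j : Fin (C + 1), if i + (j : ℕ) ≤ C then q j else 0

/-- The unnormalised law of the spin of a vertex whose children carry independent subtrees with
root laws `Q a`. -/
noncomputable def childWeight (lam : ℝ) (Q : Fin b → Fin (C + 1) → ℝ) (i : Fin (C + 1)) : ℝ :=
  lam ^ (i : ℕ) * ∏ a, compat (Q a) i

/-- The normalising constant of `childWeight`. -/
noncomputable def childNorm (lam : ℝ) (Q : Fin b → Fin (C + 1) → ℝ) : ℝ :=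
  ∑ i, childWeight lam Q i

/-- The tree recursion: the root law of a tree in terms of the root laws of its subtrees. -/
noncomputable def step (lam : ℝ) (Q : Fin b → Fin (C + 1) → ℝ) (i : Fin (C + 1)) : ℝ :=
  childWeight lam Q i / childNorm lam Q

/-- The laws on the set of spins. -/
abbrev laws (C : ℕ) : Set (Fin (C + 1) → ℝ) := stdSimplex ℝ (Fin (C + 1))

theorem compat_nonneg {q : Fin (C + 1) → ℝ} (hq : ∀ j, 0 ≤ q j) (i : ℕ) : 0 ≤ compat q i :=
  Finset.sum_nonneg fun j _ => by split_ifs <;> simp [hq]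

theorem compat_antitone {q : Fin (C + 1) → ℝ} (hq : ∀ j, 0 ≤ q j) : Antitone (compat q) := by
  intro i i' h
  refine Finset.sum_le_sum fun j _ => ?_
  split_ifs with h1 h2
  · exact le_rfl
  · omega
  · exact hq j
  · exact le_rfl

theorem compat_zero (q : Fin (C + 1) → ℝ) : compat q 0 = ∑ j, q j :=
  Finset.sum_congr rfl fun j _ => if_pos (by have := j.2; omega)

theorem compat_zero_of_mem {q : Fin (C + 1) → ℝ} (hq : q ∈ laws C) : compat q 0 = 1 := by
  rw [compat_zero, hq.2]

theorem compat_le_one {q : Fin (C + 1) → ℝ} (hq : q ∈ laws C) (i : ℕ) : compat q i ≤ 1 := by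
  rw [← compat_zero_of_mem hq]
  exact compat_antitone hq.1 (Nat.zero_le i)

theorem le_compat {q : Fin (C + 1) → ℝ} (hq : ∀ j, 0 ≤ q j) {i : ℕ} {j : Fin (C + 1)}
    (h : i + (j : ℕ) ≤ C) : q j ≤ compat q i := by
  have := Finset.single_le_sum (f := fun j : Fin (C + 1) => if i + (j : ℕ) ≤ C then q j else 0)
    (fun j _ => by split_ifs <;> simp [hq]) (Finset.mem_univ j)
  simpa [h, compat] using this

theorem compat_sub_compat (q : Fin (C + 1) → ℝ) {i j : ℕ} (h : i ≤ j) :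
    compat q i - compat q j
      = ∑ l : Fin (C + 1), if i + (l : ℕ) ≤ C ∧ C < j + (l : ℕ) then q l else 0 := by
  rw [compat, compat, ← Finset.sum_sub_distrib]
  refine Finset.sum_congr rfl fun l _ => ?_
  by_cases h1 : i + (l : ℕ) ≤ C <;> by_cases h2 : j + (l : ℕ) ≤ C
  · simp [h1, h2]
  · simp [h1, h2, Nat.lt_of_not_le h2]
  · omega
  · simp [h1, h2]

theorem one_sub_compat {q : Fin (C + 1) → ℝ} (hq : q ∈ laws C) (i : ℕ) :
    1 - compat q i = ∑ l : Fin (C + 1), if C < i + (l : ℕ) then q l else 0 := by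
  rw [← compat_zero_of_mem hq, compat_sub_compat q (Nat.zero_le i)]
  refine Finset.sum_congr rfl fun l _ => ?_
  have := l.2
  simp [show (l : ℕ) ≤ C by omega]

/-- `compat q` is the distribution function read backwards, so its increments recover `q`. Equality
and convergence of laws can therefore be tested on `compat`. -/
theorem eq_compat_sub (q : Fin (C + 1) → ℝ) (j : Fin (C + 1)) :
    q j = compat q (C - j) - compat q (C - j + 1) := by
  rw [compat_sub_compat q (Nat.le_succ _), Finset.sum_eq_single j]
  · rw [if_pos]
    have := j.2
    omega
  · intro l _ hl
    rw [if_neg]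
    have := j.2
    have : (l : ℕ) ≠ j := fun h => hl (Fin.ext h)
    omega
  · simp

theorem continuous_compat (i : ℕ) : Continuous fun q : Fin (C + 1) → ℝ => compat q i := by
  refine continuous_finsetSum _ fun j _ => ?_
  split_ifs <;> fun_prop

theorem compat_single (t : Fin (C + 1)) (i : ℕ) :
    compat (Pi.single t 1 : Fin (C + 1) → ℝ) i = if i + (t : ℕ) ≤ C then 1 else 0 := by
  rw [compat, Finset.sum_eq_single t]
  · simp
  · intro j _ hj
    simp [hj]
  · simp

theorem compat_div (q : Fin (C + 1) → ℝ) (z : ℝ) (i : ℕ) :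
    compat (fun j => q j / z) i = compat q i / z := by
  simp only [compat, Finset.sum_div]
  exact Finset.sum_congr rfl fun j _ => by split_ifs <;> simp

theorem childWeight_nonneg {lam : ℝ} (hlam : 0 < lam) {Q : Fin b → Fin (C + 1) → ℝ}
    (hQ : ∀ a, Q a ∈ laws C) (i : Fin (C + 1)) : 0 ≤ childWeight lam Q i :=
  mul_nonneg (by positivity) (Finset.prod_nonneg fun a _ => compat_nonneg (hQ a).1 _)

theorem childWeight_zero (lam : ℝ) {Q : Fin b → Fin (C + 1) → ℝ} (hQ : ∀ a, Q a ∈ laws C) :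
    childWeight lam Q 0 = 1 := by
  simp [childWeight, compat_zero_of_mem (hQ _)]

theorem one_le_childNorm {lam : ℝ} (hlam : 0 < lam) {Q : Fin b → Fin (C + 1) → ℝ}
    (hQ : ∀ a, Q a ∈ laws C) : 1 ≤ childNorm lam Q := by
  rw [← childWeight_zero lam hQ]
  exact Finset.single_le_sum (fun i _ => childWeight_nonneg hlam hQ i) (Finset.mem_univ 0)

theorem step_mem {lam : ℝ} (hlam : 0 < lam) {Q : Fin b → Fin (C + 1) → ℝ}
    (hQ : ∀ a, Q a ∈ laws C) : step lam Q ∈ laws C := by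
  have h := one_le_childNorm hlam hQ
  refine ⟨fun i => div_nonneg (childWeight_nonneg hlam hQ i) (by linarith), ?_⟩
  simp only [step]
  rw [← Finset.sum_div]
  exact div_self (by unfold childNorm at h; linarith)

theorem continuousAt_step {lam : ℝ} (hlam : 0 < lam) {Q : Fin b → Fin (C + 1) → ℝ}
    (hQ : ∀ a, Q a ∈ laws C) :
    ContinuousAt (fun Q : Fin b → Fin (C + 1) → ℝ => step lam Q) Q := by
  have hw : ∀ i, Continuous fun Q : Fin b → Fin (C + 1) → ℝ => childWeight lam Q i := fun i =>
    continuous_const.mul (continuous_finsetProd _ fun a _ =>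
      (continuous_compat _).comp (continuous_apply a))
  refine continuousAt_pi.2 fun i => ContinuousAt.div (hw i).continuousAt
    (continuous_finsetSum _ fun i _ => hw i).continuousAt ?_
  exact (zero_lt_one.trans_le (one_le_childNorm hlam hQ)).ne'

/-! ### The order reversed by the recursion -/

/-- The reversed hazard rate order on laws: the ratio of the distribution functions is
monotone. -/
def Below (q q' : Fin (C + 1) → ℝ) : Prop :=
  ∀ i j, i ≤ j → compat q' j * compat q i ≤ compat q' i * compat q j

theorem Below.compat_le {q q' : Fin (C + 1) → ℝ} (h : Below q q') (hq : q ∈ laws C)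
    (hq' : q' ∈ laws C) (i : ℕ) : compat q' i ≤ compat q i := by
  simpa [compat_zero_of_mem hq, compat_zero_of_mem hq'] using h 0 i (Nat.zero_le i)

theorem single_mem_laws (t : Fin (C + 1)) : (Pi.single t 1 : Fin (C + 1) → ℝ) ∈ laws C :=
  single_mem_stdSimplex ℝ t

theorem single_zero_below {q : Fin (C + 1) → ℝ} (hq : q ∈ laws C) :
    Below (Pi.single 0 1) q := by
  intro i j hij
  rw [compat_single, compat_single]
  by_cases hj : j ≤ C
  · simpa [hj, hij.trans hj] using compat_antitone hq.1 hij
  · have : compat q j = 0 := Finset.sum_eq_zero fun l _ => if_neg (by omega)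
    simp [hj, this]

theorem below_single_last {q : Fin (C + 1) → ℝ} (hq : q ∈ laws C) :
    Below q (Pi.single (Fin.last C) 1) := by
  intro i j hij
  rw [compat_single, compat_single]
  rcases Nat.eq_zero_or_pos j with rfl | hj
  · obtain rfl : i = 0 := by omega
    exact le_rfl
  · rw [if_neg (by simp; omega), zero_mul]
    exact mul_nonneg (by split_ifs <;> simp) (compat_nonneg hq.1 j)

/-- The likelihood ratio order implies the reversed hazard rate order. Split the sum for `i` into
the sum for `j` and a strip of larger spins: the common product cancels, and the rest compares a
spin below the strip with one inside it, term by term. -/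
theorem compat_mul_le_of_ratio {w w' : Fin (C + 1) → ℝ}
    (h : ∀ i j : Fin (C + 1), i ≤ j → w' j * w i ≤ w' i * w j) {i j : ℕ} (hij : i ≤ j) :
    compat w j * compat w' i ≤ compat w i * compat w' j := by
  have hB := compat_sub_compat w hij
  have hB' := compat_sub_compat w' hij
  set B := ∑ l : Fin (C + 1), if i + (l : ℕ) ≤ C ∧ C < j + (l : ℕ) then w l else 0 with hBd
  set B' := ∑ l : Fin (C + 1), if i + (l : ℕ) ≤ C ∧ C < j + (l : ℕ) then w' l else 0 with hBd'
  suffices hs : compat w j * B' ≤ B * compat w' j by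
    have h1 : compat w i = compat w j + B := by linarith
    have h2 : compat w' i = compat w' j + B' := by linarith
    rw [h1, h2]
    linarith
  rw [mul_comm B, hBd, hBd', compat, compat, Finset.sum_mul_sum, Finset.sum_mul_sum]
  refine Finset.sum_le_sum fun s _ => Finset.sum_le_sum fun t _ => ?_
  by_cases hs : j + (s : ℕ) ≤ C
  · by_cases ht : i + (t : ℕ) ≤ C ∧ C < j + (t : ℕ)
    · rw [if_pos hs, if_pos ht, if_pos hs, if_pos ht]
      have := h s t (Fin.le_def.2 (by omega))
      linarith
    · simp [ht]
  · simp [hs]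

/-- The ratio of the two child weights is a product of ratios of `compat`, each monotone by
hypothesis, so the outputs are even ordered by likelihood ratio. Stochastic domination of the inputs
would not control these ratios. -/
theorem step_below_step {lam : ℝ} (hlam : 0 < lam) {Q Q' : Fin b → Fin (C + 1) → ℝ}
    (hQ : ∀ a, Q a ∈ laws C) (hQ' : ∀ a, Q' a ∈ laws C) (h : ∀ a, Below (Q a) (Q' a)) :
    Below (step lam Q') (step lam Q) := by
  have hZ := one_le_childNorm hlam hQ
  have hZ' := one_le_childNorm hlam hQ'
  intro i j hij
  have hw : ∀ i j : Fin (C + 1), i ≤ j →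
      childWeight lam Q' j * childWeight lam Q i ≤ childWeight lam Q' i * childWeight lam Q j := by
    intro i j hij
    have h1 : ∏ a, (compat (Q' a) j * compat (Q a) i) ≤ ∏ a, (compat (Q' a) i * compat (Q a) j) :=
      Finset.prod_le_prod (fun a _ => mul_nonneg (compat_nonneg (hQ' a).1 _)
        (compat_nonneg (hQ a).1 _)) fun a _ => h a i j hij
    rw [Finset.prod_mul_distrib, Finset.prod_mul_distrib] at h1
    have h2 : 0 ≤ lam ^ (i : ℕ) * lam ^ (j : ℕ) := by positivity
    have := mul_le_mul_of_nonneg_left h1 h2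
    unfold childWeight
    linarith
  have := compat_mul_le_of_ratio hw hij
  have e1 : ∀ Q : Fin b → Fin (C + 1) → ℝ, ∀ i, compat (step lam Q) i
      = compat (childWeight lam Q) i / childNorm lam Q := fun Q i => compat_div _ _ i
  rw [e1, e1, e1, e1, div_mul_div_comm, div_mul_div_comm]
  exact div_le_div_of_nonneg_right this (by positivity)

/-! ### Iterates of the homogeneous recursion and the extremal pair -/

/-- The homogeneous tree recursion. -/
noncomputable def homStep (b : ℕ) (lam : ℝ) (q : Fin (C + 1) → ℝ) : Fin (C + 1) → ℝ :=
  step lam fun _ : Fin b => q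

/-- The iterates of the homogeneous recursion, started from the empty boundary condition. -/
noncomputable def iterLaw (C b : ℕ) (lam : ℝ) (n : ℕ) : Fin (C + 1) → ℝ :=
  (homStep b lam)^[n] (Pi.single 0 1)

theorem homStep_mem {lam : ℝ} (hlam : 0 < lam) {q : Fin (C + 1) → ℝ} (hq : q ∈ laws C) :
    homStep b lam q ∈ laws C :=
  step_mem hlam fun _ => hq

theorem homStep_below {lam : ℝ} (hlam : 0 < lam) {q q' : Fin (C + 1) → ℝ} (hq : q ∈ laws C)
    (hq' : q' ∈ laws C) (h : Below q q') : Below (homStep b lam q') (homStep b lam q) :=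
  step_below_step hlam (fun _ => hq) (fun _ => hq') fun _ => h

theorem iterLaw_succ (lam : ℝ) (n : ℕ) :
    iterLaw C b lam (n + 1) = homStep b lam (iterLaw C b lam n) :=
  Function.iterate_succ_apply' _ _ _

theorem iterLaw_mem {lam : ℝ} (hlam : 0 < lam) (n : ℕ) : iterLaw C b lam n ∈ laws C := by
  induction n with
  | zero => exact single_mem_laws 0
  | succ n ih => exact iterLaw_succ (C := C) (b := b) lam n ▸ homStep_mem hlam ih

/-- A vertex with a child in state `C` must be in state `0`: a full boundary acts as an empty one,
one generation closer to the root. -/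
theorem step_single_last {lam : ℝ} (hb : 0 < b) :
    step lam (fun _ : Fin b => (Pi.single (Fin.last C) 1 : Fin (C + 1) → ℝ)) = Pi.single 0 1 := by
  have hw : childWeight lam (fun _ : Fin b => (Pi.single (Fin.last C) 1 : Fin (C + 1) → ℝ))
      = Pi.single 0 1 := by
    funext i
    rcases eq_or_ne i 0 with rfl | hi
    · simp [childWeight, compat_single]
    · have : (i : ℕ) ≠ 0 := fun h => hi (Fin.ext h)
      have h2 : ¬ ((i : ℕ) + ((Fin.last C : Fin (C + 1)) : ℕ) ≤ C) := by simp; omega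
      simp [childWeight, compat_single, hi, this, hb.ne']
  funext i
  simp [step, childNorm, hw]

theorem iterLaw_even_below_odd {lam : ℝ} (hlam : 0 < lam) (n : ℕ) :
    Below (iterLaw C b lam (2 * n)) (iterLaw C b lam (2 * n + 1)) ∧
      Below (iterLaw C b lam (2 * n + 2)) (iterLaw C b lam (2 * n + 1)) := by
  induction n with
  | zero =>
    have h : Below (iterLaw C b lam 0) (iterLaw C b lam 1) := single_zero_below (iterLaw_mem hlam 1)
    refine ⟨h, ?_⟩
    have := homStep_below (b := b) hlam (iterLaw_mem hlam 0) (iterLaw_mem hlam 1) h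
    rwa [← iterLaw_succ, ← iterLaw_succ] at this
  | succ n ih =>
    have h1 := homStep_below (b := b) hlam (iterLaw_mem hlam _) (iterLaw_mem hlam _) ih.2
    rw [← iterLaw_succ, ← iterLaw_succ] at h1
    have h2 := homStep_below (b := b) hlam (iterLaw_mem hlam _) (iterLaw_mem hlam _) h1
    rw [← iterLaw_succ, ← iterLaw_succ] at h2
    exact ⟨h1, h2⟩

/-- The point mass at `0` is the least law, one step reverses the order, and two steps preserve it.
-/
theorem iterLaw_mono {lam : ℝ} (hlam : 0 < lam) (n : ℕ) :
    Below (iterLaw C b lam (2 * n)) (iterLaw C b lam (2 * n + 2)) ∧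
      Below (iterLaw C b lam (2 * n + 3)) (iterLaw C b lam (2 * n + 1)) := by
  have aux : ∀ m, Below (iterLaw C b lam m) (iterLaw C b lam (m + 2)) →
      Below (iterLaw C b lam (m + 3)) (iterLaw C b lam (m + 1)) := fun m h => by
    have := homStep_below (b := b) hlam (iterLaw_mem hlam _) (iterLaw_mem hlam _) h
    rwa [← iterLaw_succ, ← iterLaw_succ] at this
  have aux' : ∀ m, Below (iterLaw C b lam (m + 2)) (iterLaw C b lam m) →
      Below (iterLaw C b lam (m + 1)) (iterLaw C b lam (m + 3)) := fun m h => by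
    have := homStep_below (b := b) hlam (iterLaw_mem hlam _) (iterLaw_mem hlam _) h
    rwa [← iterLaw_succ, ← iterLaw_succ] at this
  induction n with
  | zero =>
    exact ⟨single_zero_below (iterLaw_mem hlam 2), aux 0 (single_zero_below (iterLaw_mem hlam 2))⟩
  | succ n ih => exact ⟨aux' _ ih.2, aux _ (aux' _ ih.2)⟩

/-- The two extremal laws `p ≤ p'`: the limits of the even and of the odd iterates. -/
structure IsExtremalPair (b : ℕ) (lam : ℝ) (p p' : Fin (C + 1) → ℝ) : Prop where
  mem : p ∈ laws C
  mem' : p' ∈ laws C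
  even : Tendsto (fun n => iterLaw C b lam (2 * n)) atTop (𝓝 p)
  odd : Tendsto (fun n => iterLaw C b lam (2 * n + 1)) atTop (𝓝 p')
  step_eq : homStep b lam p = p'
  step_eq' : homStep b lam p' = p
  compat_le : ∀ i, compat p' i ≤ compat p i

theorem exists_tendsto_of_compat {u : ℕ → Fin (C + 1) → ℝ}
    (h : ∀ i, ∃ l, Tendsto (fun n => compat (u n) i) atTop (𝓝 l)) :
    ∃ p, Tendsto u atTop (𝓝 p) := by
  choose l hl using h
  refine ⟨fun j => l (C - j) - l (C - j + 1), tendsto_pi_nhds.2 fun j => ?_⟩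
  have := (hl (C - j)).sub (hl (C - j + 1))
  simpa only [← eq_compat_sub] using this

/-- Monotonicity in `Below` makes every coordinate of `compat` monotone and bounded along each
parity; continuity of the recursion on the simplex passes the step relations to the limits. -/
theorem exists_isExtremalPair (C b : ℕ) {lam : ℝ} (hlam : 0 < lam) :
    ∃ p p' : Fin (C + 1) → ℝ, IsExtremalPair b lam p p' := by
  have hmem := iterLaw_mem (C := C) (b := b) hlam
  obtain ⟨p, hp⟩ := exists_tendsto_of_compat (u := fun n => iterLaw C b lam (2 * n)) fun i =>
    ⟨_, tendsto_atTop_ciInf (f := fun n => compat (iterLaw C b lam (2 * n)) i)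
      (antitone_nat_of_succ_le fun n => (iterLaw_mono hlam n).1.compat_le (hmem _) (hmem _) i)
      ⟨0, by rintro _ ⟨n, rfl⟩; exact compat_nonneg (hmem _).1 i⟩⟩
  obtain ⟨p', hp'⟩ := exists_tendsto_of_compat (u := fun n => iterLaw C b lam (2 * n + 1)) fun i =>
    ⟨_, tendsto_atTop_ciSup (f := fun n => compat (iterLaw C b lam (2 * n + 1)) i)
      (monotone_nat_of_le_succ fun n => (iterLaw_mono hlam n).2.compat_le (hmem _) (hmem _) i)
      ⟨1, by rintro _ ⟨n, rfl⟩; exact compat_le_one (hmem _) i⟩⟩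
  have hclosed : IsClosed (laws C) := isClosed_stdSimplex ℝ (Fin (C + 1))
  have hm : p ∈ laws C := hclosed.mem_of_tendsto hp (.of_forall fun n => hmem _)
  have hm' : p' ∈ laws C := hclosed.mem_of_tendsto hp' (.of_forall fun n => hmem _)
  have hcont : ∀ q ∈ laws C, ContinuousAt (homStep b lam : (Fin (C + 1) → ℝ) → _) q := fun q hq =>
    (continuousAt_step (b := b) hlam (Q := fun _ => q) fun _ => hq).comp
      (f := fun q : Fin (C + 1) → ℝ => fun _ : Fin b => q)
      (continuous_pi fun _ => continuous_id).continuousAt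
  refine ⟨p, p', hm, hm', hp, hp', ?_, ?_, fun i => ?_⟩
  · refine tendsto_nhds_unique ((hcont p hm).tendsto.comp hp) ?_
    simpa only [Function.comp_def, ← iterLaw_succ] using hp'
  · refine tendsto_nhds_unique ((hcont p' hm').tendsto.comp hp') ?_
    have := hp.comp (tendsto_add_atTop_nat 1)
    simp only [Function.comp_def, ← iterLaw_succ]
    exact this
  · exact le_of_tendsto_of_tendsto' (((continuous_compat i).tendsto _).comp hp')
      (((continuous_compat i).tendsto _).comp hp) fun n =>
        (iterLaw_even_below_odd hlam n).1.compat_le (hmem _) (hmem _) i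

theorem IsExtremalPair.tendsto_of_eq {lam : ℝ} {p p' : Fin (C + 1) → ℝ}
    (h : IsExtremalPair b lam p p') (he : p = p') :
    Tendsto (iterLaw C b lam) atTop (𝓝 p) := by
  subst he
  rw [Filter.tendsto_def]
  intro s hs
  have h1 := h.even.eventually hs
  have h2 := h.odd.eventually hs
  rw [eventually_atTop] at h1 h2
  obtain ⟨n1, h1⟩ := h1
  obtain ⟨n2, h2⟩ := h2
  refine mem_atTop_sets.2 ⟨2 * n1 + 2 * n2, fun n hn => ?_⟩
  rcases Nat.even_or_odd' n with ⟨m, rfl | rfl⟩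
  · exact h1 m (by omega)
  · exact h2 m (by omega)

/-! ### Tree-indexed Markov chains and their cylinder probabilities -/

/-- The spin of the parent of a vertex, and `0` for the root. -/
def prevSpin (σ : Config C b) : List (Fin b) → Fin (C + 1)
  | [] => 0
  | _ :: x => σ x

/-- The law `q` conditioned on the spins allowed next to a vertex in state `s`. -/
noncomputable def transition (q : Fin (C + 1) → ℝ) (s t : Fin (C + 1)) : ℝ :=
  -- The point mass at `0` is an arbitrary choice that keeps `transition` stochastic when the
  -- conditioning event is null.
  if compat q s = 0 then (Pi.single 0 1 : Fin (C + 1) → ℝ) t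
  else if (s : ℕ) + (t : ℕ) ≤ C then q t / compat q s else 0

theorem transition_mem {q : Fin (C + 1) → ℝ} (hq : q ∈ laws C) (s : Fin (C + 1)) :
    transition q s ∈ laws C := by
  by_cases h : compat q s = 0
  · have : transition q s = Pi.single 0 1 := funext fun t => if_pos h
    rw [this]
    exact single_mem_laws 0
  · have : transition q s
        = fun t : Fin (C + 1) => (if (s : ℕ) + (t : ℕ) ≤ C then q t else 0) / compat q s := by
      funext t
      rw [transition, if_neg h]
      split_ifs <;> simp
    rw [this]
    refine ⟨fun t => div_nonneg (by split_ifs <;> simp [hq.1 _]) (compat_nonneg hq.1 _), ?_⟩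
    rw [← Finset.sum_div]
    exact div_self h

/-- This survives the null case: if no mass is compatible with `s`, then `q t = 0` for every allowed
`t`. The telescoping in `prod_transition` needs no positivity for this reason. -/
theorem compat_mul_transition {q : Fin (C + 1) → ℝ} (hq : ∀ j, 0 ≤ q j) (s t : Fin (C + 1)) :
    compat q s * transition q s t = if (s : ℕ) + (t : ℕ) ≤ C then q t else 0 := by
  by_cases h : compat q s = 0
  · rw [h, zero_mul]
    split_ifs with hst
    · exact le_antisymm (hq t) (h ▸ le_compat hq hst)
    · rfl
  · rw [transition, if_neg h]
    split_ifs
    · field_simp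
    · simp

/-- A law on the spins as a probability mass function. -/
noncomputable def lawPMF (q : Fin (C + 1) → ℝ) (hq : q ∈ laws C) : PMF (Fin (C + 1)) :=
  PMF.ofFintype (fun t => ENNReal.ofReal (q t)) (by
    rw [← ENNReal.ofReal_sum_of_nonneg fun t _ => hq.1 t, hq.2, ENNReal.ofReal_one])

/-- The configuration obtained from the root outwards by the rule `g`, which maps a vertex and the
spin of its parent to the spin of the vertex. -/
def chain (g : List (Fin b) × Fin (C + 1) → Fin (C + 1)) : Config C b
  | [] => g ([], 0)
  | a :: x => g (a :: x, chain g x)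

theorem chain_eq (g : List (Fin b) × Fin (C + 1) → Fin (C + 1)) (v : List (Fin b)) :
    chain g v = g (v, prevSpin (chain g) v) := by
  cases v <;> rfl

theorem measurable_chain :
    Measurable (chain : (List (Fin b) × Fin (C + 1) → Fin (C + 1)) → Config C b) := by
  refine measurable_pi_iff.2 fun v => ?_
  induction v with
  | nil => exact measurable_pi_apply _
  | cons a x ih =>
    refine measurable_to_countable' fun t => ?_
    have : (fun g : List (Fin b) × Fin (C + 1) → Fin (C + 1) => chain g (a :: x)) ⁻¹' {t}
        = ⋃ s, (fun g => chain g x) ⁻¹' {s} ∩ (fun g => g (a :: x, s)) ⁻¹' {t} := by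
      ext g
      simp [chain]
    rw [this]
    exact MeasurableSet.iUnion fun s => (ih (measurableSet_singleton s)).inter
      (measurable_pi_apply _ (measurableSet_singleton t))

/-- The tree-indexed Markov chain in which the spin of `v` given the spin of its parent has the law
`q v` conditioned on the hard constraint. -/
noncomputable def chainMeasure (q : List (Fin b) → Fin (C + 1) → ℝ) (hq : ∀ v, q v ∈ laws C) :
    Measure (Config C b) :=
  (Measure.infinitePi fun p : List (Fin b) × Fin (C + 1) =>
    (lawPMF (transition (q p.1) p.2) (transition_mem (hq p.1) p.2)).toMeasure).map chain

instance (q : List (Fin b) → Fin (C + 1) → ℝ) (hq : ∀ v, q v ∈ laws C) :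
    IsProbabilityMeasure (chainMeasure q hq) :=
  Measure.isProbabilityMeasure_map measurable_chain.aemeasurable

/-- The configurations that agree with `ω` on `U`. -/
def cylinder (U : Finset (List (Fin b))) (ω : Config C b) : Set (Config C b) :=
  {σ | ∀ v ∈ U, σ v = ω v}

theorem measurableSet_cylinder (U : Finset (List (Fin b))) (ω : Config C b) :
    MeasurableSet (cylinder U ω) := by
  have : cylinder U ω = Set.pi U fun v => {ω v} := by
    ext σ
    simp [cylinder, Set.mem_pi]
  rw [this]
  exact MeasurableSet.pi (Finset.countable_toSet U) fun v _ => measurableSet_singleton _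

theorem mem_ball {n : ℕ} {v : List (Fin b)} : v ∈ ball b n ↔ v.length ≤ n := by
  simp [ball]

/-- On a ball the event prescribes one value of `g` for each vertex, at the parent spin read from
`ω`. It is thus a product event for the independent rules that define `chainMeasure`. -/
theorem chain_mem_cylinder_iff (g : List (Fin b) × Fin (C + 1) → Fin (C + 1)) (ω : Config C b)
    (n : ℕ) : chain g ∈ cylinder (ball b n) ω ↔ ∀ v ∈ ball b n, g (v, prevSpin ω v) = ω v := by
  have hprev : ∀ v ∈ ball b n, (∀ w ∈ ball b n, w.length < v.length → chain g w = ω w) →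
      prevSpin (chain g) v = prevSpin ω v := by
    intro v hv h
    cases v with
    | nil => rfl
    | cons a x =>
      have := mem_ball.1 hv
      simp only [List.length_cons] at this
      exact h x (mem_ball.2 (by omega)) (by simp)
  constructor
  · intro h v hv
    rw [← hprev v hv fun w hw _ => h w hw, ← chain_eq g v]
    exact h v hv
  · intro h v hv
    induction hl : v.length using Nat.strong_induction_on generalizing v with
    | _ l ih =>
      rw [chain_eq, hprev v hv fun w hw hlt => ih _ (hl ▸ hlt) w hw rfl]
      exact h v hv

theorem chainMeasure_cylinder (q : List (Fin b) → Fin (C + 1) → ℝ) (hq : ∀ v, q v ∈ laws C)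
    (n : ℕ) (ω : Config C b) :
    (chainMeasure q hq).real (cylinder (ball b n) ω)
      = ∏ v ∈ ball b n, transition (q v) (prevSpin ω v) (ω v) := by
  classical
  have hpre : chain ⁻¹' cylinder (ball b n) ω
      = Set.pi ((ball b n).image fun v => (v, prevSpin ω v) : Finset _) fun p => {ω p.1} := by
    ext g
    rw [Set.mem_preimage, chain_mem_cylinder_iff]
    simp [Set.mem_pi]
  rw [chainMeasure, map_measureReal_apply measurable_chain (measurableSet_cylinder _ _), hpre,
    Measure.real, Measure.infinitePi_pi _ fun p _ => measurableSet_singleton _,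
    Finset.prod_image fun v _ w _ h => congrArg Prod.fst h, ENNReal.toReal_prod]
  refine Finset.prod_congr rfl fun v _ => ?_
  rw [PMF.toMeasure_apply_singleton _ _ (measurableSet_singleton _)]
  exact ENNReal.toReal_ofReal ((transition_mem (hq v) _).1 _)

/-- The vertices at distance `n` from the root. -/
noncomputable def sphere (b n : ℕ) : Finset (List (Fin b)) :=
  (ball b n).filter fun v => v.length = n

theorem mem_sphere {n : ℕ} {v : List (Fin b)} : v ∈ sphere b n ↔ v.length = n := by
  simp only [sphere, Finset.mem_filter, mem_ball]
  omega

theorem prod_ball_succ (f : List (Fin b) → ℝ) (n : ℕ) :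
    ∏ v ∈ ball b (n + 1), f v = (∏ v ∈ ball b n, f v) * ∏ v ∈ sphere b (n + 1), f v := by
  classical
  rw [← Finset.prod_union]
  · refine Finset.prod_congr ?_ fun _ _ => rfl
    ext v
    simp only [Finset.mem_union, mem_ball, mem_sphere]
    omega
  · refine Finset.disjoint_left.2 fun v h1 h2 => ?_
    rw [mem_ball] at h1
    rw [mem_sphere] at h2
    omega

theorem prod_sphere_succ (f : List (Fin b) → ℝ) (n : ℕ) :
    ∏ v ∈ sphere b (n + 1), f v = ∏ v ∈ sphere b n, ∏ a, f (a :: v) := by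
  rw [← Finset.prod_product']
  symm
  refine Finset.prod_bij (fun p _ => p.2 :: p.1) ?_ ?_ ?_ fun _ _ => rfl
  · intro p hp
    simp only [Finset.mem_product, mem_sphere] at hp
    simp [mem_sphere, hp.1]
  · rintro ⟨x, a⟩ _ ⟨y, c⟩ _ h
    simp only [List.cons.injEq] at h
    simp [h.1, h.2]
  · intro v hv
    rw [mem_sphere] at hv
    cases v with
    | nil => simp at hv
    | cons a x => exact ⟨(x, a), by simpa [mem_sphere] using hv, rfl⟩

theorem ball_zero : ball b 0 = {[]} := by
  ext v
  simp [mem_ball]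

theorem sphere_zero : sphere b 0 = {[]} := by
  ext v
  simp [mem_sphere]

/-- The probability of a cylinder of a Markov chain whose laws satisfy the tree recursion. -/
theorem prod_transition {lam : ℝ} {q : List (Fin b) → Fin (C + 1) → ℝ}
    (hq : ∀ v, q v ∈ laws C) {n : ℕ}
    (hrec : ∀ v : List (Fin b), v.length ≤ n → q v = step lam fun a => q (a :: v))
    (ω : Config C b) :
    ∏ v ∈ ball b n, transition (q v) (prevSpin ω v) (ω v)
      = (∏ v ∈ ball b n, lam ^ (ω v : ℕ) / childNorm lam fun a => q (a :: v))
        * (∏ v ∈ ball b n, if (prevSpin ω v : ℕ) + ω v ≤ C then 1 else 0)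
        * ∏ v ∈ sphere b n, ∏ a, compat (q (a :: v)) (ω v) := by
  -- The factors `compat (q (a :: v)) (ω v)` contributed by `v` are the conditioning constants of
  -- its children. Multiplying over the generations telescopes, and only the factors of the
  -- outermost sphere survive.
  have hstep : ∀ v : List (Fin b), v.length ≤ n →
      compat (q v) (prevSpin ω v) * transition (q v) (prevSpin ω v) (ω v)
        = (lam ^ (ω v : ℕ) / childNorm lam fun a => q (a :: v))
          * (if (prevSpin ω v : ℕ) + ω v ≤ C then 1 else 0)
          * ∏ a, compat (q (a :: v)) (ω v) := by
    intro v hv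
    rw [compat_mul_transition (hq v).1]
    split_ifs
    · rw [hrec v hv, step, childWeight]
      ring
    · simp
  induction n with
  | zero =>
    have := hstep [] le_rfl
    have h0 : compat (q []) (prevSpin ω []) = 1 := compat_zero_of_mem (hq _)
    rw [h0, one_mul] at this
    simpa only [ball_zero, sphere_zero, Finset.prod_singleton] using this
  | succ n ih =>
    have h1 := ih (fun v hv => hrec v (by omega)) fun v hv => hstep v (by omega)
    have h2 : ∏ v ∈ sphere b n, ∏ a, compat (q (a :: v)) (ω v)
        = ∏ v ∈ sphere b (n + 1), compat (q v) (prevSpin ω v) := by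
      rw [prod_sphere_succ]
      rfl
    have h3 := Finset.prod_congr rfl fun v hv => hstep v (mem_sphere (n := n + 1).1 hv).le
    simp only [Finset.prod_mul_distrib] at h3
    rw [prod_ball_succ, h1, h2, mul_assoc, h3, prod_ball_succ, prod_ball_succ]
    ring

theorem glue_of_mem {U : Finset (List (Fin b))} {τ : Config C b} {η : U → Fin (C + 1)}
    {v : List (Fin b)} (h : v ∈ U) : glue U τ η v = η ⟨v, h⟩ := dif_pos h

theorem glue_of_notMem {U : Finset (List (Fin b))} {τ : Config C b} {η : U → Fin (C + 1)}
    {v : List (Fin b)} (h : v ∉ U) : glue U τ η v = τ v := dif_neg h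

theorem prod_pow_glue (lam : ℝ) {U V : Finset (List (Fin b))} (hUV : U ⊆ V) (τ : Config C b)
    (η : U → Fin (C + 1)) :
    ∏ v ∈ V, lam ^ (glue U τ η v : ℕ)
      = (∏ v ∈ V, lam ^ (glue U τ 0 v : ℕ)) * ∏ v : U, lam ^ (η v : ℕ) := by
  classical
  rw [← Finset.prod_sdiff hUV, ← Finset.prod_sdiff hUV]
  have h1 : ∏ v ∈ V \ U, lam ^ (glue U τ η v : ℕ) = ∏ v ∈ V \ U, lam ^ (glue U τ 0 v : ℕ) :=
    Finset.prod_congr rfl fun v hv => by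
      rw [glue_of_notMem (Finset.mem_sdiff.1 hv).2, glue_of_notMem (Finset.mem_sdiff.1 hv).2]
  have h2 : ∏ v ∈ U, lam ^ (glue U τ 0 v : ℕ) = 1 :=
    Finset.prod_eq_one fun v hv => by simp [glue_of_mem hv]
  have h3 : ∏ v ∈ U, lam ^ (glue U τ η v : ℕ) = ∏ v : U, lam ^ (η v : ℕ) := by
    rw [← Finset.prod_coe_sort]
    exact Finset.prod_congr rfl fun v _ => by rw [glue_of_mem v.2]
  rw [h1, h2, h3]
  ring

/-- The filling `0` is the least restrictive one, so feasibility of `η` splits into a condition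
without `η` and the constraint on the edges meeting `U`. -/
theorem forall_prevSpin_glue_iff {U : Finset (List (Fin b))} {n : ℕ}
    (hU : ∀ v ∈ U, v.length < n) (τ : Config C b) (η : U → Fin (C + 1)) :
    (∀ v ∈ ball b n, (prevSpin (glue U τ η) v : ℕ) + glue U τ η v ≤ C) ↔
      (∀ v ∈ ball b n, (prevSpin (glue U τ 0) v : ℕ) + glue U τ 0 v ≤ C) ∧
        FeasibleOn U (glue U τ η) := by
  have hle : ∀ v, (glue U τ 0 v : ℕ) ≤ glue U τ η v := fun v => by
    by_cases h : v ∈ U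
    · simp [glue_of_mem h]
    · simp [glue_of_notMem h]
  constructor
  · refine fun h => ⟨fun v hv => ?_, fun x hx y hxy => ?_⟩
    · have h1 := h v hv
      have h2 : (prevSpin (glue U τ 0) v : ℕ) ≤ prevSpin (glue U τ η) v := by
        cases v with
        | nil => exact le_rfl
        | cons a x => exact hle x
      have := hle v
      omega
    · have hl := hU x hx
      rcases hxy with ⟨a, rfl⟩ | ⟨a, rfl⟩
      · exact h (a :: x) (mem_ball.2 (by simp; omega))
      · have : (glue U τ η y : ℕ) + glue U τ η (a :: y) ≤ C := h (a :: y) (mem_ball.2 hl.le)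
        omega
  · rintro ⟨h0, hf⟩ v hv
    cases v with
    | nil => simpa [prevSpin] using Nat.lt_succ_iff.1 (glue U τ η []).2
    | cons a x =>
      change (glue U τ η x : ℕ) + glue U τ η (a :: x) ≤ C
      by_cases h1 : x ∈ U
      · exact hf x h1 _ (Or.inl ⟨a, rfl⟩)
      · by_cases h2 : a :: x ∈ U
        · have := hf _ h2 x (Or.inr ⟨a, rfl⟩)
          omega
        · have : (glue U τ 0 x : ℕ) + glue U τ 0 (a :: x) ≤ C := h0 _ hv
          rw [glue_of_notMem h1, glue_of_notMem h2] at this ⊢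
          exact this

/-- The spatial Markov property of the chain, on cylinders. -/
theorem chainMeasure_cylinder_glue {lam : ℝ} {q : List (Fin b) → Fin (C + 1) → ℝ}
    (hq : ∀ v, q v ∈ laws C) {n : ℕ}
    (hrec : ∀ v : List (Fin b), v.length ≤ n → q v = step lam fun a => q (a :: v))
    {U : Finset (List (Fin b))} (hU : ∀ v ∈ U, v.length < n) (τ : Config C b)
    (η : U → Fin (C + 1)) :
    (chainMeasure q hq).real (cylinder (ball b n) (glue U τ η))
      = (chainMeasure q hq).real (cylinder (ball b n) (glue U τ 0)) * weight C b lam U τ η := by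
  have hUb : U ⊆ ball b n := fun v hv => mem_ball.2 (hU v hv).le
  -- Since `U` stays strictly inside the ball, the outermost factors do not see `η`.
  have hsph : ∏ v ∈ sphere b n, ∏ a, compat (q (a :: v)) (glue U τ η v)
      = ∏ v ∈ sphere b n, ∏ a, compat (q (a :: v)) (glue U τ 0 v) := by
    refine Finset.prod_congr rfl fun v hv => ?_
    have : v ∉ U := fun h => (hU v h).ne (mem_sphere.1 hv)
    rw [glue_of_notMem this, glue_of_notMem this]
  rw [chainMeasure_cylinder, chainMeasure_cylinder, prod_transition hq hrec,
    prod_transition hq hrec, hsph, Finset.prod_div_distrib, Finset.prod_div_distrib,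
    prod_pow_glue lam hUb, Finset.prod_boole, Finset.prod_boole, weight]
  have hiff := forall_prevSpin_glue_iff hU τ η
  by_cases h : ∀ v ∈ ball b n, (prevSpin (glue U τ η) v : ℕ) + glue U τ η v ≤ C
  · rw [if_pos h, if_pos (hiff.1 h).1, if_pos (hiff.1 h).2]
    ring
  · rw [if_neg h]
    by_cases h0 : ∀ v ∈ ball b n, (prevSpin (glue U τ 0) v : ℕ) + glue U τ 0 v ≤ C
    · rw [if_neg fun hf => h (hiff.2 ⟨h0, hf⟩)]
      ring
    · rw [if_neg h0]
      ring

/-! ### Finite-volume measures as Markov chains -/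

/-- The root law of the subtree of height `h` above `v` with boundary condition `τ`. -/
noncomputable def fieldLaw (lam : ℝ) (τ : Config C b) : ℕ → List (Fin b) → Fin (C + 1) → ℝ
  | 0, v => Pi.single (τ v) 1
  | h + 1, v => step lam fun a => fieldLaw lam τ h (a :: v)

theorem fieldLaw_mem {lam : ℝ} (hlam : 0 < lam) (τ : Config C b) (h : ℕ) (v : List (Fin b)) :
    fieldLaw lam τ h v ∈ laws C := by
  induction h generalizing v with
  | zero => exact single_mem_laws _
  | succ h ih => exact step_mem hlam fun a => ih _

/-- The Markov chain whose restriction to `T_n` is the finite-volume measure with boundary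
condition `τ`. -/
noncomputable def boundaryMeasure {lam : ℝ} (hlam : 0 < lam) (n : ℕ) (τ : Config C b) :
    Measure (Config C b) :=
  chainMeasure (fun v => fieldLaw lam τ (n + 1 - v.length) v) fun v => fieldLaw_mem hlam τ _ v

instance {lam : ℝ} (hlam : 0 < lam) (n : ℕ) (τ : Config C b) :
    IsProbabilityMeasure (boundaryMeasure hlam n τ) := by
  unfold boundaryMeasure
  infer_instance

theorem fieldLaw_rec (lam : ℝ) (τ : Config C b) {n : ℕ} {v : List (Fin b)} (hv : v.length ≤ n) :
    fieldLaw lam τ (n + 1 - v.length) v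
      = step lam fun a => fieldLaw lam τ (n + 1 - (a :: v).length) (a :: v) := by
  have : n + 1 - v.length = (n - v.length) + 1 := by omega
  simp only [this, fieldLaw, List.length_cons, Nat.add_sub_add_right]

theorem feasibleOn_ball_iff (n : ℕ) (ω : Config C b) :
    FeasibleOn (ball b n) ω ↔ (∀ v ∈ ball b n, (prevSpin ω v : ℕ) + ω v ≤ C) ∧
      ∀ v ∈ sphere b n, ∀ a, (ω v : ℕ) + ω (a :: v) ≤ C := by
  constructor
  · refine fun h => ⟨fun v hv => ?_, fun v hv a =>
      h v (mem_ball.2 (mem_sphere.1 hv).le) _ (Or.inl ⟨a, rfl⟩)⟩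
    cases v with
    | nil => simpa [prevSpin] using Nat.lt_succ_iff.1 (ω []).2
    | cons a x =>
      have := h _ hv x (Or.inr ⟨a, rfl⟩)
      change (ω x : ℕ) + ω (a :: x) ≤ C
      omega
  · rintro ⟨h1, h2⟩ x hx y (⟨a, rfl⟩ | ⟨a, rfl⟩)
    · rcases (mem_ball.1 hx).lt_or_eq with hl | hl
      · exact h1 (a :: x) (mem_ball.2 (by simp; omega))
      · exact h2 x (mem_sphere.2 hl) a
    · have : (ω y : ℕ) + ω (a :: y) ≤ C := h1 _ hx
      omega

theorem measureReal_eq_sum (ρ : Measure (Config C b)) [IsFiniteMeasure ρ]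
    (U : Finset (List (Fin b))) (τ : Config C b) (A : Set (Config C b)) (hA : MeasurableSet A) :
    ρ.real A = ∑ η : U → Fin (C + 1), ρ.real (A ∩ cylinder U (glue U τ η)) := by
  rw [← measureReal_iUnion_fintype]
  · congr 1
    ext σ
    simp only [Set.mem_iUnion, Set.mem_inter_iff]
    exact ⟨fun h => ⟨fun v => σ v, h, fun v hv => (glue_of_mem (η := fun v : U => σ v) hv).symm⟩,
      fun ⟨_, h, _⟩ => h⟩
  · intro η η' hne
    refine Set.disjoint_left.2 fun σ h h' => hne (funext fun v => ?_)
    have h1 := h.2 v v.2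
    have h2 := h'.2 v v.2
    rw [glue_of_mem v.2] at h1 h2
    exact h1.symm.trans h2
  · exact fun η => hA.inter (measurableSet_cylinder _ _)

/-- The chain gives each `η` its weight times a constant independent of `η`. Both sides have total
mass one, so that constant must be the inverse of the partition function. -/
theorem finVolProb_ball {lam : ℝ} (hlam : 0 < lam) (n : ℕ) (τ : Config C b)
    (η : ball b n → Fin (C + 1)) :
    finVolProb C b lam (ball b n) τ η
      = (boundaryMeasure hlam n τ).real (cylinder (ball b n) (glue (ball b n) τ η)) := by
  have hq : ∀ v : List (Fin b), fieldLaw lam τ (n + 1 - v.length) v ∈ laws C := fun v =>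
    fieldLaw_mem hlam τ _ v
  have key : ∀ η : ball b n → Fin (C + 1),
      (boundaryMeasure hlam n τ).real (cylinder (ball b n) (glue (ball b n) τ η))
        = weight C b lam (ball b n) τ η * (∏ v ∈ ball b n,
          childNorm lam fun a => fieldLaw lam τ (n + 1 - (a :: v).length) (a :: v))⁻¹ := by
    intro η
    have hs : ∏ v ∈ sphere b n, ∏ a, compat
        (fieldLaw lam τ (n + 1 - (a :: v).length) (a :: v)) (glue (ball b n) τ η v)
        = if ∀ v ∈ sphere b n, ∀ a, (glue (ball b n) τ η v : ℕ) + glue (ball b n) τ η (a :: v) ≤ C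
          then 1 else 0 := by
      rw [← Finset.prod_boole]
      refine Finset.prod_congr rfl fun v hv => ?_
      have hl := mem_sphere.1 hv
      have hterm : ∀ a, compat (fieldLaw lam τ (n + 1 - (a :: v).length) (a :: v))
          (glue (ball b n) τ η v) = if (glue (ball b n) τ η v : ℕ)
            + glue (ball b n) τ η (a :: v) ≤ C then 1 else 0 := by
        intro a
        have h0 : n + 1 - (a :: v).length = 0 := by simp [hl]
        have hn : a :: v ∉ ball b n := fun h => by
          have := mem_ball.1 h
          simp [hl] at this
        rw [h0, fieldLaw, compat_single, glue_of_notMem hn]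
      simp only [hterm, Fintype.prod_boole]
      congr
    have h1 := prod_pow_glue lam (Finset.Subset.refl (ball b n)) τ η
    have h2 : ∏ v ∈ ball b n, lam ^ (glue (ball b n) τ 0 v : ℕ) = 1 :=
      Finset.prod_eq_one fun v hv => by simp [glue_of_mem hv]
    rw [h2, one_mul] at h1
    rw [boundaryMeasure, chainMeasure_cylinder, prod_transition hq fun v hv =>
      fieldLaw_rec lam τ hv, hs, Finset.prod_div_distrib, Finset.prod_boole, h1, weight]
    have hf := feasibleOn_ball_iff n (glue (ball b n) τ η)
    by_cases h : FeasibleOn (ball b n) (glue (ball b n) τ η)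
    · rw [if_pos h, if_pos (hf.1 h).1, if_pos (hf.1 h).2]
      ring
    · rw [if_neg h]
      by_cases h3 : ∀ v ∈ ball b n, (prevSpin (glue (ball b n) τ η) v : ℕ)
          + glue (ball b n) τ η v ≤ C
      · rw [if_neg fun h4 => h (hf.2 ⟨h3, h4⟩)]
        ring
      · rw [if_neg h3]
        ring
  have hsum := measureReal_eq_sum (boundaryMeasure hlam n τ) (ball b n) τ Set.univ
    MeasurableSet.univ
  simp only [Set.univ_inter, key, ← Finset.sum_mul, probReal_univ] at hsum
  rw [key, finVolProb, partitionFn, eq_inv_of_mul_eq_one_right hsum.symm, div_eq_mul_inv]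

theorem ballProb_eq {lam : ℝ} (hlam : 0 < lam) (n : ℕ) (t : Fin (C + 1)) (P : Fin (C + 1) → Prop) :
    ballProb C b lam n t {σ | P (σ [])}
      = (boundaryMeasure (C := C) (b := b) hlam n fun _ => t).real {σ | P (σ [])} := by
  classical
  have hA : MeasurableSet {σ : Config C b | P (σ [])} :=
    (measurable_pi_apply ([] : List (Fin b))) (MeasurableSet.of_discrete (s := {i | P i}))
  rw [measureReal_eq_sum _ (ball b n) (fun _ => t) _ hA, ballProb]
  refine Finset.sum_congr rfl fun η _ => ?_
  have h0 : ([] : List (Fin b)) ∈ ball b n := mem_ball.2 (Nat.zero_le _)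
  split_ifs with h
  · rw [finVolProb_ball hlam]
    congr 1
    refine (Set.inter_eq_right.2 fun σ hσ => ?_).symm
    change P (σ [])
    rw [hσ [] h0]
    exact h
  · rw [eq_comm, Set.eq_empty_of_forall_notMem (s := _ ∩ _), measureReal_empty]
    rintro σ ⟨h1, h2⟩
    refine h ?_
    change P _
    rw [← h2 [] h0]
    exact h1

theorem chainMeasure_root (q : List (Fin b) → Fin (C + 1) → ℝ) (hq : ∀ v, q v ∈ laws C)
    (P : Fin (C + 1) → Prop) [DecidablePred P] :
    (chainMeasure q hq).real {σ | P (σ [])} = ∑ i, if P i then q [] i else 0 := by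
  have hset : {σ : Config C b | P (σ [])}
      = ⋃ i ∈ Finset.univ.filter P, cylinder (ball b 0) fun _ => i := by
    ext σ
    simp [cylinder, ball_zero]
  rw [hset, measureReal_biUnion_finset, Finset.sum_filter]
  · refine Finset.sum_congr rfl fun i _ => ?_
    rw [chainMeasure_cylinder, ball_zero, Finset.prod_singleton]
    have := compat_mul_transition (hq []).1 0 i
    have hi := i.2
    rw [Fin.val_zero, compat_zero_of_mem (hq _), one_mul, if_pos (by omega)] at this
    rw [show prevSpin (fun _ : List (Fin b) => i) [] = 0 from rfl, this]
  · intro i _ j _ hij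
    refine Set.disjoint_left.2 fun σ h h' => hij ?_
    have h0 : ([] : List (Fin b)) ∈ ball b 0 := mem_ball.2 le_rfl
    exact (h [] h0).symm.trans (h' [] h0)
  · exact fun i _ => measurableSet_cylinder _ _

theorem ballProb_eq_sum {lam : ℝ} (hlam : 0 < lam) (n : ℕ) (t : Fin (C + 1))
    (P : Fin (C + 1) → Prop) [DecidablePred P] :
    ballProb C b lam n t {σ | P (σ [])}
      = ∑ i, if P i then fieldLaw (b := b) lam (fun _ => t) (n + 1) [] i else 0 := by
  rw [ballProb_eq hlam, boundaryMeasure, chainMeasure_root]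
  rfl

theorem fieldLaw_zero (lam : ℝ) (h : ℕ) (v : List (Fin b)) :
    fieldLaw lam (fun _ => (0 : Fin (C + 1))) h v = iterLaw C b lam h := by
  induction h generalizing v with
  | zero => rfl
  | succ h ih =>
    rw [iterLaw_succ, fieldLaw]
    simp only [ih]
    rfl

theorem fieldLaw_last (hb : 0 < b) (lam : ℝ) (h : ℕ) (v : List (Fin b)) :
    fieldLaw lam (fun _ => Fin.last C) (h + 1) v = iterLaw C b lam h := by
  induction h generalizing v with
  | zero => exact step_single_last hb
  | succ h ih =>
    rw [iterLaw_succ, fieldLaw]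
    simp only [ih]
    rfl

/-! ### The Gibbs property of the infinite Markov chains -/

/-- Every finite vertex set lies in some large ball, so the large balls already determine the
projective family. -/
theorem measure_eq_of_cylinder {μ ν : Measure (Config C b)} [IsFiniteMeasure μ]
    [IsFiniteMeasure ν] (n₀ : ℕ) (h : ∀ n, n₀ ≤ n → ∀ ω,
      μ.real (cylinder (ball b n) ω) = ν.real (cylinder (ball b n) ω)) : μ = ν := by
  have hball : ∀ n, n₀ ≤ n →
      μ.map (Finset.restrict (π := fun _ : List (Fin b) => Fin (C + 1)) (ball b n))
        = ν.map (Finset.restrict (π := fun _ : List (Fin b) => Fin (C + 1)) (ball b n)) := by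
    intro n hn
    refine Measure.ext_of_singleton fun ζ => ?_
    have hpre : Finset.restrict (π := fun _ : List (Fin b) => Fin (C + 1)) (ball b n) ⁻¹' {ζ}
        = cylinder (ball b n) (glue (ball b n) 0 ζ) := by
      ext σ
      simp only [Set.mem_preimage, Set.mem_singleton_iff, funext_iff, cylinder, Set.mem_ofPred_eq]
      exact ⟨fun h v hv => (h ⟨v, hv⟩).trans (glue_of_mem hv).symm,
        fun h v => (h v v.2).trans (glue_of_mem v.2)⟩
    rw [Measure.map_apply (Finset.measurable_restrict _) (measurableSet_singleton _),
      Measure.map_apply (Finset.measurable_restrict _) (measurableSet_singleton _), hpre]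
    exact (measureReal_eq_measureReal_iff).1 (h n hn _)
  refine IsProjectiveLimit.unique (P := fun I : Finset (List (Fin b)) => μ.map I.restrict)
    (fun I => rfl) fun I => ?_
  obtain ⟨n, hn, hI⟩ : ∃ n, n₀ ≤ n ∧ I ⊆ ball b n :=
    ⟨max n₀ (I.sup List.length), le_max_left _ _, fun v hv =>
      mem_ball.2 ((Finset.le_sup (f := List.length) hv).trans (le_max_right _ _))⟩
  have := congrArg (Measure.map (Finset.restrict₂ (π := fun _ : List (Fin b) => Fin (C + 1)) hI))
    (hball n hn)
  rw [Measure.map_map (Finset.measurable_restrict₂ hI) (Finset.measurable_restrict _),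
    Measure.map_map (Finset.measurable_restrict₂ hI) (Finset.measurable_restrict _)] at this
  exact this.symm

theorem weight_congr {U : Finset (List (Fin b))} {n : ℕ} (hU : ∀ v ∈ U, v.length < n) (lam : ℝ)
    {τ τ' : Config C b} (h : ∀ v ∈ ball b n, v ∉ U → τ v = τ' v) (η : U → Fin (C + 1)) :
    weight C b lam U τ η = weight C b lam U τ' η := by
  have hg : ∀ v ∈ ball b n, glue U τ η v = glue U τ' η v := by
    intro v hv
    by_cases hvU : v ∈ U
    · rw [glue_of_mem hvU, glue_of_mem hvU]
    · rw [glue_of_notMem hvU, glue_of_notMem hvU, h v hv hvU]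
  have : FeasibleOn U (glue U τ η) ↔ FeasibleOn U (glue U τ' η) := by
    refine forall₂_congr fun x hx => forall₂_congr fun y hxy => ?_
    have hl := hU x hx
    have hy : y ∈ ball b n := by
      rw [mem_ball]
      rcases hxy with ⟨a, rfl⟩ | ⟨a, rfl⟩ <;> simp only [List.length_cons] at * <;> omega
    rw [hg x (mem_ball.2 hl.le), hg y hy]
  classical
  unfold weight
  exact if_congr this rfl rfl

theorem finVolProb_congr {U : Finset (List (Fin b))} {n : ℕ} (hU : ∀ v ∈ U, v.length < n)
    (lam : ℝ) {τ τ' : Config C b} (h : ∀ v ∈ ball b n, v ∉ U → τ v = τ' v)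
    (η : U → Fin (C + 1)) : finVolProb C b lam U τ η = finVolProb C b lam U τ' η := by
  simp only [finVolProb, partitionFn, weight_congr hU lam h]

theorem weight_nonneg {lam : ℝ} (hlam : 0 < lam) (U : Finset (List (Fin b))) (τ : Config C b)
    (η : U → Fin (C + 1)) : 0 ≤ weight C b lam U τ η := by
  unfold weight
  split_ifs
  · exact Finset.prod_nonneg fun v _ => by positivity
  · exact le_rfl

theorem weight_zero (lam : ℝ) (U : Finset (List (Fin b))) (τ : Config C b) :
    weight C b lam U τ 0 = 1 := by
  rw [weight, if_pos]
  · simp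
  · intro x hx y _
    simpa [glue_of_mem hx] using Nat.lt_succ_iff.1 (glue U τ 0 y).2

theorem partitionFn_pos {lam : ℝ} (hlam : 0 < lam) (U : Finset (List (Fin b)))
    (τ : Config C b) : 0 < partitionFn C b lam U τ := by
  refine zero_lt_one.trans_le ?_
  rw [← weight_zero lam U τ]
  exact Finset.single_le_sum (fun η _ => weight_nonneg hlam U τ η) (Finset.mem_univ 0)

theorem finVolProb_nonneg {lam : ℝ} (hlam : 0 < lam) (U : Finset (List (Fin b)))
    (τ : Config C b) (η : U → Fin (C + 1)) : 0 ≤ finVolProb C b lam U τ η :=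
  div_nonneg (weight_nonneg hlam U τ η) (partitionFn_pos hlam U τ).le

theorem finVolProb_le_one {lam : ℝ} (hlam : 0 < lam) (U : Finset (List (Fin b)))
    (τ : Config C b) (η : U → Fin (C + 1)) : finVolProb C b lam U τ η ≤ 1 :=
  div_le_one_of_le₀ (Finset.single_le_sum (fun η _ => weight_nonneg hlam U τ η)
    (Finset.mem_univ η)) (partitionFn_pos hlam U τ).le

theorem outside_le (U : Finset (List (Fin b))) :
    outside C b U ≤ (inferInstance : MeasurableSpace (Config C b)) :=
  iSup_le fun v => (measurable_pi_apply (v : List (Fin b))).comap_le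

theorem outside_eq_comap (U : Finset (List (Fin b))) :
    outside C b U = MeasurableSpace.comap
      (fun (σ : Config C b) (v : {v // v ∉ U}) => σ v) MeasurableSpace.pi := by
  rw [MeasurableSpace.pi, MeasurableSpace.comap_iSup]
  simp only [MeasurableSpace.comap_comp]
  rfl

theorem mem_iff_of_measurableSet_outside {U : Finset (List (Fin b))} {s : Set (Config C b)}
    (hs : MeasurableSet[outside C b U] s) {σ σ' : Config C b} (h : ∀ v, v ∉ U → σ v = σ' v) :
    σ ∈ s ↔ σ' ∈ s := by
  rw [outside_eq_comap] at hs
  obtain ⟨t, _, rfl⟩ := hs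
  have : (fun v : {v // v ∉ U} => σ v) = fun v : {v // v ∉ U} => σ' v := funext fun v => h v v.2
  simp only [Set.mem_preimage, this]

theorem exists_length_lt (U : Finset (List (Fin b))) : ∃ n, ∀ v ∈ U, v.length < n :=
  ⟨U.sup List.length + 1, fun _ hv => Nat.lt_succ_of_le (Finset.le_sup (f := List.length) hv)⟩

/-- Only finitely many spins outside `U` matter, so the function factors through a finite set. -/
theorem measurable_finVolProb (lam : ℝ) (U : Finset (List (Fin b))) (η : U → Fin (C + 1)) :
    Measurable[outside C b U] fun τ => finVolProb C b lam U τ η := by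
  classical
  obtain ⟨n, hU⟩ := exists_length_lt U
  have hV : Measurable[outside C b U] (ball b n \ U).restrict := by
    refine @measurable_pi_iff _ _ _ (outside C b U) _ _ |>.2 fun v => ?_
    refine Measurable.mono (comap_measurable _) ?_ le_rfl
    exact le_iSup (fun v : {v // v ∉ U} =>
      MeasurableSpace.comap (fun σ : Config C b => σ v) ⊤) ⟨v, (Finset.mem_sdiff.1 v.2).2⟩
  have : (fun τ => finVolProb C b lam U τ η)
      = (fun ζ => finVolProb C b lam U (glue (ball b n \ U) 0 ζ) η) ∘ (ball b n \ U).restrict := by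
    funext τ
    refine finVolProb_congr hU lam (fun v hv hvU => ?_) η
    rw [glue_of_mem (Finset.mem_sdiff.2 ⟨hv, hvU⟩)]
    rfl
  rw [this]
  exact (measurable_of_finite _).comp hV

theorem cylinder_sdiff_inter {U V : Finset (List (Fin b))} [DecidableEq (List (Fin b))]
    (hUV : U ⊆ V) (ω : Config C b) (η : U → Fin (C + 1)) :
    cylinder (V \ U) ω ∩ cylinder U (glue U ω η) = cylinder V (glue U ω η) := by
  ext σ
  constructor
  · rintro ⟨h1, h2⟩ v hv
    by_cases hvU : v ∈ U
    · exact h2 v hvU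
    · rw [glue_of_notMem hvU]
      exact h1 v (Finset.mem_sdiff.2 ⟨hv, hvU⟩)
  · refine fun h => ⟨fun v hv => ?_, fun v hv => h v (hUV hv)⟩
    rw [h v (Finset.mem_sdiff.1 hv).1, glue_of_notMem (Finset.mem_sdiff.1 hv).2]

theorem cylinder_glue (U : Finset (List (Fin b))) (ω : Config C b) (η : U → Fin (C + 1)) :
    cylinder U (glue U ω η) = {σ | ∀ v : U, σ v = η v} := by
  ext σ
  exact ⟨fun h v => (h v v.2).trans (glue_of_mem v.2),
    fun h v hv => (h ⟨v, hv⟩).trans (glue_of_mem hv).symm⟩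

theorem measurable_glue_zero (U : Finset (List (Fin b))) :
    Measurable fun σ : Config C b => glue U σ 0 := by
  refine measurable_pi_iff.2 fun v => ?_
  by_cases h : v ∈ U
  · simp only [glue_of_mem h]
    exact measurable_const
  · simp only [glue_of_notMem h]
    exact measurable_pi_apply v

/-- The map `r` resets the spins in `U` to `0`. The chain restricted to the event and the chain with
density `finVolProb` have the same image under `r`, by comparison on cylinders. Sets measurable
outside `U` are invariant under `r`, so the two measures agree on them. -/
theorem setIntegral_finVolProb {lam : ℝ} (hlam : 0 < lam)
    {q : List (Fin b) → Fin (C + 1) → ℝ} (hq : ∀ v, q v ∈ laws C)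
    (hrec : ∀ v : List (Fin b), q v = step lam fun a => q (a :: v))
    (U : Finset (List (Fin b))) (η : U → Fin (C + 1)) {s : Set (Config C b)}
    (hs : MeasurableSet[outside C b U] s) :
    ∫ τ in s, finVolProb C b lam U τ η ∂(chainMeasure q hq)
      = (chainMeasure q hq).real (s ∩ {σ | ∀ v : U, σ v = η v}) := by
  classical
  set μ := chainMeasure q hq with hμ
  set w : Config C b → ℝ := fun τ => finVolProb C b lam U τ η with hw
  set r : Config C b → Config C b := fun σ => glue U σ 0
  have hr1 : ∀ σ v, v ∈ U → r σ v = 0 := fun σ v hv => glue_of_mem hv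
  have hr2 : ∀ σ v, v ∉ U → r σ v = σ v := fun σ v hv => glue_of_notMem hv
  have hrm : Measurable r := measurable_glue_zero U
  have hwm : Measurable w := (measurable_finVolProb lam U η).mono (outside_le U) le_rfl
  have hE : MeasurableSet {σ : Config C b | ∀ v : U, σ v = η v} := by
    rw [← cylinder_glue U 0 η]
    exact measurableSet_cylinder _ _
  have hwi : Integrable w μ := Integrable.of_bound hwm.aestronglyMeasurable 1
    (.of_forall fun τ => by
      rw [Real.norm_of_nonneg (finVolProb_nonneg hlam U τ η)]
      exact finVolProb_le_one hlam U τ η)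
  have hint : ∀ A, MeasurableSet A →
      (μ.withDensity fun τ => ENNReal.ofReal (w τ)).real A = ∫ τ in A, w τ ∂μ := by
    intro A hA
    rw [Measure.real, withDensity_apply _ hA, integral_eq_lintegral_of_nonneg_ae
      (.of_forall fun τ => finVolProb_nonneg hlam U τ η) hwm.aestronglyMeasurable]
  have : IsFiniteMeasure (μ.withDensity fun τ => ENNReal.ofReal (w τ)) :=
    isFiniteMeasure_withDensity_ofReal hwi.2
  obtain ⟨n₀, hU⟩ := exists_length_lt U
  have heq : (μ.restrict {σ | ∀ v : U, σ v = η v}).map r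
      = (μ.withDensity fun τ => ENNReal.ofReal (w τ)).map r := by
    refine measure_eq_of_cylinder n₀ fun n hn ω => ?_
    have hUn : ∀ v ∈ U, v.length < n := fun v hv => (hU v hv).trans_le hn
    have hUb : U ⊆ ball b n := fun v hv => mem_ball.2 (hUn v hv).le
    rw [map_measureReal_apply hrm (measurableSet_cylinder _ _),
      map_measureReal_apply hrm (measurableSet_cylinder _ _)]
    by_cases h0 : ∀ v ∈ U, ω v = 0
    · have hpre : r ⁻¹' cylinder (ball b n) ω = cylinder (ball b n \ U) ω := by
        ext σ
        constructor
        · intro h v hv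
          have := h v (Finset.mem_sdiff.1 hv).1
          rwa [hr2 σ v (Finset.mem_sdiff.1 hv).2] at this
        · intro h v hv
          by_cases hvU : v ∈ U
          · rw [hr1 σ v hvU, h0 v hvU]
          · rw [hr2 σ v hvU]
            exact h v (Finset.mem_sdiff.2 ⟨hv, hvU⟩)
      have hconst : ∫ τ in cylinder (ball b n \ U) ω, w τ ∂μ
          = ∫ τ in cylinder (ball b n \ U) ω, w ω ∂μ :=
        setIntegral_congr_fun (measurableSet_cylinder _ _) fun τ hτ =>
          finVolProb_congr hUn lam (fun v hv hvU => hτ v (Finset.mem_sdiff.2 ⟨hv, hvU⟩)) η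
      have hg : ∀ η : U → Fin (C + 1), μ.real (cylinder (ball b n) (glue U ω η))
          = μ.real (cylinder (ball b n) (glue U ω 0)) * weight C b lam U ω η := fun η =>
        chainMeasure_cylinder_glue hq (fun v _ => hrec v) hUn ω η
      have hsum : μ.real (cylinder (ball b n \ U) ω)
          = μ.real (cylinder (ball b n) (glue U ω 0)) * partitionFn C b lam U ω := by
        rw [measureReal_eq_sum μ U ω _ (measurableSet_cylinder _ _), partitionFn, Finset.mul_sum]
        exact Finset.sum_congr rfl fun η _ => by rw [cylinder_sdiff_inter hUb, hg]
      rw [hpre, hint _ (measurableSet_cylinder _ _), hconst, setIntegral_const,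
        measureReal_restrict_apply (measurableSet_cylinder _ _), ← cylinder_glue U ω η,
        cylinder_sdiff_inter hUb, hg, hsum, hw, smul_eq_mul]
      have hZ := (partitionFn_pos hlam U ω).ne'
      simp only [finVolProb]
      field_simp
    · have hpre : r ⁻¹' cylinder (ball b n) ω = ∅ := by
        refine Set.eq_empty_of_forall_notMem fun σ h => h0 fun v hv => ?_
        have := h v (hUb hv)
        rw [hr1 σ v hv] at this
        exact this.symm
      rw [hpre]
      simp
  have hsm : MeasurableSet s := outside_le U s hs
  have hrs : r ⁻¹' s = s := by
    ext σ
    exact mem_iff_of_measurableSet_outside hs fun v hv => hr2 σ v hv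
  have := congrArg (Measure.real · s) heq
  rw [map_measureReal_apply hrm hsm, map_measureReal_apply hrm hsm, hrs, hint s hsm,
    measureReal_restrict_apply hsm] at this
  exact this.symm

theorem isGibbs_chainMeasure {lam : ℝ} (hlam : 0 < lam)
    {q : List (Fin b) → Fin (C + 1) → ℝ} (hq : ∀ v, q v ∈ laws C)
    (hrec : ∀ v : List (Fin b), q v = step lam fun a => q (a :: v)) :
    IsGibbs C b lam (chainMeasure q hq) := by
  refine ⟨inferInstance, fun U η => ?_⟩
  have hE : MeasurableSet {σ : Config C b | ∀ v : U, σ v = η v} := by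
    rw [← cylinder_glue U 0 η]
    exact measurableSet_cylinder _ _
  have hwm := measurable_finVolProb (C := C) lam U η
  refine (ae_eq_condExp_of_forall_setIntegral_eq (outside_le U)
    ((integrable_const (1 : ℝ)).indicator hE) (fun s _ _ => ?_) (fun s hs _ => ?_)
    hwm.stronglyMeasurable.aestronglyMeasurable).symm
  · refine Integrable.integrableOn (Integrable.of_bound
      (hwm.mono (outside_le U) le_rfl).aestronglyMeasurable 1 (.of_forall fun τ => ?_))
    rw [Real.norm_of_nonneg (finVolProb_nonneg hlam U τ η)]
    exact finVolProb_le_one hlam U τ η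
  · rw [setIntegral_finVolProb hlam hq hrec U η hs, setIntegral_indicator hE, setIntegral_const,
      smul_eq_mul, mul_one]

/-! ### Uniqueness and coexistence in terms of the extremal pair -/

theorem IsGibbs.integral_finVolProb {lam : ℝ} {μ : Measure (Config C b)}
    (h : IsGibbs C b lam μ) (U : Finset (List (Fin b))) (η : U → Fin (C + 1)) :
    Integrable (fun τ => finVolProb C b lam U τ η) μ ∧
      ∫ τ, finVolProb C b lam U τ η ∂μ = μ.real {σ | ∀ v : U, σ v = η v} := by
  have := h.isProbabilityMeasure
  have hE : MeasurableSet {σ : Config C b | ∀ v : U, σ v = η v} := by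
    rw [← cylinder_glue U 0 η]
    exact measurableSet_cylinder _ _
  refine ⟨integrable_condExp.congr (h.condExp_eq U η), ?_⟩
  rw [← integral_congr_ae (h.condExp_eq U η), integral_condExp (outside_le U),
    integral_indicator hE, setIntegral_const, smul_eq_mul, mul_one]

theorem cylinder_inter_cylinder_glue {n N : ℕ} (hn : n ≤ N) (ω τ : Config C b)
    (η : ball b N → Fin (C + 1)) (ρ : Measure (Config C b)) [IsFiniteMeasure ρ]
    [Decidable (∀ v : ball b N, (v : List (Fin b)) ∈ ball b n → η v = ω v)] :
    ρ.real (cylinder (ball b n) ω ∩ cylinder (ball b N) (glue (ball b N) τ η))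
      = if ∀ v : ball b N, (v : List (Fin b)) ∈ ball b n → η v = ω v
        then ρ.real (cylinder (ball b N) (glue (ball b N) τ η)) else 0 := by
  have hsub : ∀ v ∈ ball b n, v ∈ ball b N := fun v hv => mem_ball.2 ((mem_ball.1 hv).trans hn)
  split_ifs with h
  · congr 1
    refine Set.inter_eq_right.2 fun σ hσ v hv => ?_
    rw [hσ v (hsub v hv), glue_of_mem (hsub v hv), h ⟨v, hsub v hv⟩ hv]
  · rw [Set.eq_empty_of_forall_notMem (s := _ ∩ _), measureReal_empty]
    rintro σ ⟨h1, h2⟩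
    refine h fun v hv => ?_
    rw [← h1 v hv, h2 v v.2, glue_of_mem v.2]

/-- Taking expectations in the Gibbs property on the larger ball writes `μ` as a mixture of
finite-volume measures, with boundary condition sampled from `μ` itself. -/
theorem IsGibbs.cylinder_eq_integral {lam : ℝ} (hlam : 0 < lam) {μ : Measure (Config C b)}
    (h : IsGibbs C b lam μ) {n N : ℕ} (hn : n ≤ N) (ω : Config C b) :
    Integrable (fun τ => (boundaryMeasure hlam N τ).real (cylinder (ball b n) ω)) μ ∧
      μ.real (cylinder (ball b n) ω)
        = ∫ τ, (boundaryMeasure hlam N τ).real (cylinder (ball b n) ω) ∂μ := by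
  classical
  have := h.isProbabilityMeasure
  have h1 : ∀ τ, (boundaryMeasure hlam N τ).real (cylinder (ball b n) ω)
      = ∑ η : ball b N → Fin (C + 1),
        if ∀ v : ball b N, (v : List (Fin b)) ∈ ball b n → η v = ω v
        then finVolProb C b lam (ball b N) τ η else 0 := by
    intro τ
    rw [measureReal_eq_sum _ (ball b N) τ _ (measurableSet_cylinder _ _)]
    refine Finset.sum_congr rfl fun η _ => ?_
    rw [cylinder_inter_cylinder_glue hn, finVolProb_ball hlam]
  have hi : ∀ η : ball b N → Fin (C + 1), Integrable (fun τ =>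
      if ∀ v : ball b N, (v : List (Fin b)) ∈ ball b n → η v = ω v
        then finVolProb C b lam (ball b N) τ η else 0) μ := by
    intro η
    split_ifs
    · exact (h.integral_finVolProb _ η).1
    · exact integrable_zero _ _ _
  simp only [h1]
  refine ⟨integrable_finsetSum _ fun η _ => hi η, ?_⟩
  rw [integral_finsetSum _ fun η _ => hi η,
    measureReal_eq_sum μ (ball b N) 0 _ (measurableSet_cylinder _ _)]
  refine Finset.sum_congr rfl fun η _ => ?_
  rw [cylinder_inter_cylinder_glue hn]
  split_ifs
  · rw [(h.integral_finVolProb _ η).2, cylinder_glue]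
  · simp

/-- At height zero the constant boundaries give the least and the greatest law; each step reverses
the order, so the parity of the height decides which of them is the lower bound. -/
theorem fieldLaw_between {lam : ℝ} (hlam : 0 < lam) (τ : Config C b) (h : ℕ) (v : List (Fin b)) :
    (Even h → Below (fieldLaw lam (fun _ => 0) h v) (fieldLaw lam τ h v) ∧
      Below (fieldLaw lam τ h v) (fieldLaw lam (fun _ => Fin.last C) h v)) ∧
    (¬ Even h → Below (fieldLaw lam τ h v) (fieldLaw lam (fun _ => 0) h v) ∧
      Below (fieldLaw lam (fun _ => Fin.last C) h v) (fieldLaw lam τ h v)) := by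
  have hm := fieldLaw_mem (C := C) (b := b) hlam
  induction h generalizing v with
  | zero =>
    exact ⟨fun _ => ⟨single_zero_below (hm _ 0 v), below_single_last (hm _ 0 v)⟩,
      fun h => (h Even.zero).elim⟩
  | succ h ih =>
    rw [Nat.even_add_one, not_not]
    constructor
    · intro he
      exact ⟨step_below_step hlam (fun a => hm _ _ _) (fun a => hm _ _ _) fun a => ((ih _).2 he).1,
        step_below_step hlam (fun a => hm _ _ _) (fun a => hm _ _ _) fun a => ((ih _).2 he).2⟩
    · intro he
      exact ⟨step_below_step hlam (fun a => hm _ _ _) (fun a => hm _ _ _) fun a => ((ih _).1 he).1,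
        step_below_step hlam (fun a => hm _ _ _) (fun a => hm _ _ _) fun a => ((ih _).1 he).2⟩

theorem compat_fieldLaw_between {lam : ℝ} (hlam : 0 < lam) (hb : 0 < b) (τ : Config C b) (h : ℕ)
    (v : List (Fin b)) (i : ℕ) :
    min (compat (iterLaw C b lam (h + 1)) i) (compat (iterLaw C b lam h) i)
        ≤ compat (fieldLaw lam τ (h + 1) v) i ∧
      compat (fieldLaw lam τ (h + 1) v) i
        ≤ max (compat (iterLaw C b lam (h + 1)) i) (compat (iterLaw C b lam h) i) := by
  have hm := fieldLaw_mem (C := C) (b := b) hlam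
  have hB := fieldLaw_between hlam τ (h + 1) v
  rw [← fieldLaw_zero lam (h + 1) v, ← fieldLaw_last hb lam h v]
  by_cases he : Even (h + 1)
  · obtain ⟨h1, h2⟩ := hB.1 he
    exact ⟨(min_le_right _ _).trans (h2.compat_le (hm _ _ _) (hm _ _ _) i),
      (h1.compat_le (hm _ _ _) (hm _ _ _) i).trans (le_max_left _ _)⟩
  · obtain ⟨h1, h2⟩ := hB.2 he
    exact ⟨(min_le_left _ _).trans (h1.compat_le (hm _ _ _) (hm _ _ _) i),
      (h2.compat_le (hm _ _ _) (hm _ _ _) i).trans (le_max_right _ _)⟩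

/-- For every boundary condition the law is squeezed between two consecutive iterates, which share
the limit `p`. -/
theorem tendsto_fieldLaw {lam : ℝ} (hlam : 0 < lam) (hb : 0 < b) {p : Fin (C + 1) → ℝ}
    (hp : Tendsto (iterLaw C b lam) atTop (𝓝 p)) (τ : Config C b) (v : List (Fin b)) :
    Tendsto (fun h => fieldLaw lam τ h v) atTop (𝓝 p) := by
  rw [← tendsto_add_atTop_iff_nat 1]
  have hc : ∀ i, Tendsto (fun h => compat (fieldLaw lam τ (h + 1) v) i) atTop (𝓝 (compat p i)) := by
    intro i
    have h1 := ((continuous_compat i).tendsto p).comp hp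
    have h2 := h1.comp (tendsto_add_atTop_nat 1)
    have hmin := h2.min h1
    have hmax := h2.max h1
    rw [min_self] at hmin
    rw [max_self] at hmax
    exact tendsto_of_tendsto_of_tendsto_of_le_of_le hmin hmax
      (fun h => (compat_fieldLaw_between hlam hb τ h v i).1)
      fun h => (compat_fieldLaw_between hlam hb τ h v i).2
  refine tendsto_pi_nhds.2 fun j => ?_
  have := (hc (C - j)).sub (hc (C - j + 1))
  simpa only [← eq_compat_sub] using this

theorem tendsto_transition {q : ℕ → Fin (C + 1) → ℝ} {p : Fin (C + 1) → ℝ}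
    (hq : Tendsto q atTop (𝓝 p)) {s : Fin (C + 1)} (hs : compat p s ≠ 0) (t : Fin (C + 1)) :
    Tendsto (fun n => transition (q n) s t) atTop (𝓝 (transition p s t)) := by
  have hc := ((continuous_compat s).tendsto p).comp hq
  rw [transition, if_neg hs]
  have hev : ∀ᶠ n in atTop, (if (s : ℕ) + (t : ℕ) ≤ C then q n t / compat (q n) s else 0)
      = transition (q n) s t := by
    filter_upwards [hc.eventually_ne hs] with n hn
    exact (if_neg hn).symm
  refine Tendsto.congr' hev ?_
  split_ifs
  · exact (tendsto_pi_nhds.1 hq t).div hc hs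
  · exact tendsto_const_nhds

theorem homStep_zero_pos {lam : ℝ} (hlam : 0 < lam) {q : Fin (C + 1) → ℝ} (hq : q ∈ laws C) :
    0 < homStep b lam q 0 := by
  have h := one_le_childNorm (b := b) hlam (Q := fun _ => q) fun _ => hq
  rw [homStep, step, childWeight_zero lam fun _ => hq]
  exact div_pos one_pos (by linarith)

/-- Finite-volume cylinder probabilities converge, for every boundary condition, to those of the
chain built from `p`. Dominated convergence transfers this to an arbitrary Gibbs measure through
`IsGibbs.cylinder_eq_integral`. -/
theorem gibbsUnique_of_eq {lam : ℝ} (hlam : 0 < lam) (hb : 0 < b) {p p' : Fin (C + 1) → ℝ}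
    (h : IsExtremalPair b lam p p') (he : p = p') : GibbsUnique C b lam := by
  have hlim := h.tendsto_of_eq he
  subst he
  refine ⟨chainMeasure (fun _ => p) fun _ => h.mem,
    isGibbs_chainMeasure hlam _ fun _ => h.step_eq.symm, fun μ hμ => ?_⟩
  have := hμ.isProbabilityMeasure
  -- Spin `0` is compatible with every state and has positive mass, so conditioning is continuous at
  -- `p`.
  have hpos : ∀ s : Fin (C + 1), compat p s ≠ 0 := by
    intro s
    have h0 : 0 < p 0 := by
      rw [← h.step_eq]
      exact homStep_zero_pos hlam h.mem
    have hs := s.2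
    exact (h0.trans_le (le_compat h.mem.1 (by simp; omega))).ne'
  refine measure_eq_of_cylinder 0 fun n _ ω => ?_
  have hpt : ∀ τ, Tendsto (fun N => (boundaryMeasure hlam N τ).real (cylinder (ball b n) ω)) atTop
      (𝓝 ((chainMeasure (fun _ => p) fun _ => h.mem).real (cylinder (ball b n) ω))) := by
    intro τ
    simp only [boundaryMeasure, chainMeasure_cylinder]
    refine tendsto_finsetProd _ fun v _ => tendsto_transition ?_ (hpos _) _
    exact (tendsto_fieldLaw hlam hb hlim τ v).comp
      ((tendsto_sub_atTop_nat _).comp (tendsto_add_atTop_nat 1))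
  have hint : Tendsto (fun N => ∫ τ, (boundaryMeasure hlam (N + n) τ).real
      (cylinder (ball b n) ω) ∂μ) atTop (𝓝 (∫ _, (chainMeasure (fun _ => p) fun _ => h.mem).real
        (cylinder (ball b n) ω) ∂μ)) := by
    refine tendsto_integral_of_dominated_convergence (fun _ => 1) (fun N =>
      (hμ.cylinder_eq_integral hlam (Nat.le_add_left n N) ω).1.aestronglyMeasurable)
      (integrable_const _) (fun N => .of_forall fun τ => ?_)
      (.of_forall fun τ => (hpt τ).comp (tendsto_add_atTop_nat n))
    rw [Real.norm_of_nonneg measureReal_nonneg]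
    exact measureReal_le_one
  simp only [← (hμ.cylinder_eq_integral hlam (Nat.le_add_left n _) ω).2, integral_const,
    probReal_univ, one_smul] at hint
  exact tendsto_nhds_unique tendsto_const_nhds hint

/-- `p` and `p'` form a two-cycle of the recursion, so assigning them alternately to the generations
satisfies the recursion at every vertex. The two possible assignments have different root marginals.
-/
theorem phaseCoexistence_of_ne {lam : ℝ} (hlam : 0 < lam) {p p' : Fin (C + 1) → ℝ}
    (h : IsExtremalPair b lam p p') (hne : p ≠ p') : PhaseCoexistence C b lam := by
  have aux : ∀ {r r' : Fin (C + 1) → ℝ}, r ∈ laws C → r' ∈ laws C → homStep b lam r = r' →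
      homStep b lam r' = r → ∃ μ : Measure (Config C b), IsGibbs C b lam μ ∧
        ∀ i, μ.real {σ | σ [] = i} = r i := by
    intro r r' hr hr' h1 h2
    have hq : ∀ v : List (Fin b), (if Even v.length then r else r') ∈ laws C := fun v => by
      split_ifs <;> assumption
    refine ⟨chainMeasure (fun v => if Even v.length then r else r') hq,
      isGibbs_chainMeasure hlam hq fun v => ?_, fun i => ?_⟩
    · by_cases hv : Even v.length
      · simp only [hv, if_true, List.length_cons, Nat.even_add_one, not_true, if_false]
        exact h2.symm
      · simp only [hv, if_false, List.length_cons, Nat.even_add_one, not_false_iff, if_true]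
        exact h1.symm
    · rw [chainMeasure_root _ hq (fun j => j = i)]
      simp
  obtain ⟨μ, hμ, h1⟩ := aux h.mem h.mem' h.step_eq h.step_eq'
  obtain ⟨ν, hν, h2⟩ := aux h.mem' h.mem h.step_eq' h.step_eq
  refine ⟨μ, ν, hμ, hν, ?_⟩
  rintro rfl
  exact hne (funext fun i => (h1 i).symm.trans (h2 i))

theorem phaseCoexistence_iff {lam : ℝ} (hlam : 0 < lam) (hb : 0 < b) {p p' : Fin (C + 1) → ℝ}
    (h : IsExtremalPair b lam p p') : PhaseCoexistence C b lam ↔ p ≠ p' := by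
  refine ⟨?_, phaseCoexistence_of_ne hlam h⟩
  rintro ⟨μ, ν, hμ, hν, hne⟩ he
  exact hne ((gibbsUnique_of_eq hlam hb h he).unique hμ hν)

/-! ### One-step estimates for the recursion -/

variable {k : ℕ} {lam : ℝ}

theorem sum_tail_le (h0 : 0 < lam) (h1 : lam < 1) (m : ℕ) :
    ∑ l : Fin (C + 1), (if m ≤ (l : ℕ) then lam ^ (l : ℕ) else 0) ≤ lam ^ m / (1 - lam) := by
  rw [Fin.sum_univ_eq_sum_range (fun l => if m ≤ l then lam ^ l else 0) (C + 1),
    ← Finset.sum_filter]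
  refine le_trans (le_of_eq ?_) (geom_sum_Ico_le_of_lt_one (m := m) (n := C + 1) h0.le h1)
  refine Finset.sum_congr ?_ fun _ _ => rfl
  ext l
  simp [and_comm]

theorem homStep_le (h0 : 0 < lam) {p : Fin (C + 1) → ℝ} (hp : p ∈ laws C) (i : Fin (C + 1)) :
    homStep b lam p i ≤ lam ^ (i : ℕ) * compat p i ^ b := by
  have hw := childWeight_nonneg (b := b) h0 (Q := fun _ => p) (fun _ => hp) i
  refine (div_le_self hw (one_le_childNorm h0 fun _ => hp)).trans (le_of_eq ?_)
  simp [childWeight]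

theorem childNorm_le (h0 : 0 < lam) (h1 : lam < 1) {p : Fin (C + 1) → ℝ} (hp : p ∈ laws C) :
    childNorm lam (fun _ : Fin b => p) ≤ 1 / (1 - lam) := by
  have := sum_tail_le (C := C) h0 h1 0
  simp only [Nat.zero_le, if_true, pow_zero] at this
  refine le_trans (Finset.sum_le_sum fun i _ => ?_) this
  rw [childWeight, Finset.prod_const]
  exact mul_le_of_le_one_right (by positivity)
    (pow_le_one₀ (compat_nonneg hp.1 _) (compat_le_one hp _))

theorem le_homStep (h0 : 0 < lam) (h1 : lam < 1) {p : Fin (C + 1) → ℝ} (hp : p ∈ laws C)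
    (i : Fin (C + 1)) : (1 - lam) * (lam ^ (i : ℕ) * compat p i ^ b) ≤ homStep b lam p i := by
  have hZ := childNorm_le (b := b) h0 h1 hp
  have hZ1 := one_le_childNorm (b := b) h0 (Q := fun _ => p) fun _ => hp
  have hw : childWeight lam (fun _ : Fin b => p) i = lam ^ (i : ℕ) * compat p i ^ b := by
    simp [childWeight]
  have hw0 := childWeight_nonneg (b := b) h0 (Q := fun _ => p) (fun _ => hp) i
  rw [homStep, step, ← hw, le_div_iff₀ (by linarith)]
  have h2 : 0 < 1 - lam := by linarith
  rw [le_div_iff₀ h2] at hZ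
  nlinarith

/-- `C + 1 - i` is the smallest spin forbidden next to `i`; larger spins constrain the children at
least as much, and the powers of `lam` sum geometrically. -/
theorem one_sub_compat_homStep_le (h0 : 0 < lam) (h1 : lam < 1) {p : Fin (C + 1) → ℝ}
    (hp : p ∈ laws C) {i : ℕ} (hi : i ≤ C) :
    1 - compat (homStep b lam p) i ≤ lam ^ (C + 1 - i) / (1 - lam) * compat p (C + 1 - i) ^ b := by
  rw [one_sub_compat (homStep_mem h0 hp)]
  refine le_trans ?_ (mul_le_mul_of_nonneg_right (sum_tail_le (C := C) h0 h1 (C + 1 - i))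
    (pow_nonneg (compat_nonneg hp.1 (C + 1 - i)) b))
  rw [Finset.sum_mul]
  refine Finset.sum_le_sum fun l _ => ?_
  by_cases h : C < i + (l : ℕ)
  · rw [if_pos h, if_pos (by omega)]
    refine (homStep_le h0 hp l).trans (mul_le_mul_of_nonneg_left ?_ (by positivity))
    exact pow_le_pow_left₀ (compat_nonneg hp.1 _) (compat_antitone hp.1 (by omega)) b
  · rw [if_neg h, if_neg (by omega), zero_mul]

theorem compat_homStep_le (h0 : 0 < lam) (h1 : lam < 1) {p : Fin (C + 1) → ℝ}
    (hp : p ∈ laws C) {i j : ℕ} (hj : j ≤ C) (hij : C < i + j) :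
    compat (homStep b lam p) i ≤ 1 - (1 - lam) * (lam ^ j * compat p j ^ b) := by
  have h := le_homStep (b := b) h0 h1 hp ⟨j, by omega⟩
  have hm := homStep_mem (b := b) h0 hp
  have hs := one_sub_compat hm i
  have := Finset.single_le_sum (f := fun l : Fin (C + 1) => if C < i + (l : ℕ)
    then homStep b lam p l else 0) (fun l _ => by split_ifs <;> simp [hm.1 _])
    (Finset.mem_univ (⟨j, by omega⟩ : Fin (C + 1)))
  simp only [hij, if_true] at this
  simp only at h
  linarith

theorem pow_sub_pow_le_mul {x y : ℝ} (hy : 0 ≤ y) (hxy : y ≤ x) (n : ℕ) :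
    x ^ (n + 1) - y ^ (n + 1) ≤ (n + 1) * (x - y) * x ^ n := by
  induction n with
  | zero => simp
  | succ n ih =>
    have h1 : y ^ (n + 1) ≤ x ^ (n + 1) := pow_le_pow_left₀ hy hxy _
    have h2 := mul_le_mul_of_nonneg_left ih (hy.trans hxy)
    have h3 := mul_le_mul_of_nonneg_right h1 (sub_nonneg.2 hxy)
    push_cast
    calc x ^ (n + 1 + 1) - y ^ (n + 1 + 1)
        = x * (x ^ (n + 1) - y ^ (n + 1)) + y ^ (n + 1) * (x - y) := by ring
      _ ≤ x * ((n + 1) * (x - y) * x ^ n) + x ^ (n + 1) * (x - y) := add_le_add h2 h3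
      _ = _ := by ring

/-- The child weights from `p` dominate those from `p'`, so the normalising constants are ordered
favourably and can be dropped from `p' l - p l`. What is left is a difference of `b`-th powers. -/
theorem IsExtremalPair.gap_le {p p' : Fin (C + 1) → ℝ} (h : IsExtremalPair b lam p p')
    (h0 : 0 < lam) (hb : 0 < b) (i : ℕ) :
    compat p i - compat p' i ≤ ∑ l : Fin (C + 1), if C < i + (l : ℕ) then
      lam ^ (l : ℕ) * (b * (compat p l - compat p' l) * compat p l ^ (b - 1)) else 0 := by
  have hw : ∀ l, childWeight lam (fun _ : Fin b => p') l
      ≤ childWeight lam (fun _ : Fin b => p) l := by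
    intro l
    refine mul_le_mul_of_nonneg_left ?_ (by positivity)
    exact Finset.prod_le_prod (fun _ _ => compat_nonneg h.mem'.1 _) fun _ _ => h.compat_le _
  have hZ : childNorm lam (fun _ : Fin b => p') ≤ childNorm lam (fun _ : Fin b => p) :=
    Finset.sum_le_sum fun l _ => hw l
  have hZ1 := one_le_childNorm (b := b) h0 (Q := fun _ => p') fun _ => h.mem'
  have hdiff : compat p i - compat p' i
      = ∑ l : Fin (C + 1), if C < i + (l : ℕ) then p' l - p l else 0 := by
    have h1 := one_sub_compat h.mem i
    have h2 := one_sub_compat h.mem' i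
    have : compat p i - compat p' i = (1 - compat p' i) - (1 - compat p i) := by ring
    rw [this, h1, h2, ← Finset.sum_sub_distrib]
    exact Finset.sum_congr rfl fun l _ => by split_ifs <;> simp
  rw [hdiff]
  refine Finset.sum_le_sum fun l _ => ?_
  split_ifs
  · have e1 : p' l = childWeight lam (fun _ : Fin b => p) l / childNorm lam (fun _ : Fin b => p) :=
      congrFun h.step_eq.symm l
    have e2 : p l = childWeight lam (fun _ : Fin b => p') l
        / childNorm lam (fun _ : Fin b => p') := congrFun h.step_eq'.symm l
    have h1 : p' l ≤ childWeight lam (fun _ : Fin b => p) l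
        / childNorm lam (fun _ : Fin b => p') := by
      rw [e1]
      exact div_le_div_of_nonneg_left (childWeight_nonneg h0 (fun _ => h.mem) l) (by linarith) hZ
    have h2 : p' l - p l ≤ childWeight lam (fun _ : Fin b => p) l
        - childWeight lam (fun _ : Fin b => p') l := by
      refine le_trans ?_ (div_le_self (sub_nonneg.2 (hw l)) hZ1)
      rw [sub_div, ← e2]
      linarith
    refine h2.trans ?_
    simp only [childWeight, Finset.prod_const, Finset.card_univ, Fintype.card_fin, ← mul_sub]
    refine mul_le_mul_of_nonneg_left ?_ (by positivity)
    have := pow_sub_pow_le_mul (compat_nonneg h.mem'.1 l) (h.compat_le l) (b - 1)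
    have hb1 : b - 1 + 1 = b := by omega
    have hb2 : ((b - 1 : ℕ) : ℝ) + 1 = b := by exact_mod_cast hb1
    rwa [hb1, hb2] at this
  · exact le_rfl

/-! ### Contraction of the gap between the extremal laws -/

section Contraction

variable {p p' : Fin (C + 1) → ℝ} {H E : ℝ}

theorem IsExtremalPair.high_term_le (h : IsExtremalPair b lam p p') (hE : 0 ≤ E)
    (hH : ∀ i, k < i → i ≤ C → b * lam ^ (C + 1 - i) * compat p i ^ (b - 1) ≤ H)
    (hgap : ∀ i, k < i → i ≤ C → compat p i - compat p' i ≤ E * lam ^ (C + 1 - i))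
    (l : Fin (C + 1)) (hl : k < l) :
    b * (compat p l - compat p' l) * compat p l ^ (b - 1) ≤ E * H := by
  have hlC : (l : ℕ) ≤ C := by omega
  have h1 := hgap l hl hlC
  have h2 := hH l hl hlC
  have h3 : 0 ≤ compat p l ^ (b - 1) := pow_nonneg (compat_nonneg h.mem.1 _) _
  calc (b : ℝ) * (compat p l - compat p' l) * compat p l ^ (b - 1)
      ≤ b * (E * lam ^ (C + 1 - (l : ℕ))) * compat p l ^ (b - 1) := by gcongr
    _ = E * (b * lam ^ (C + 1 - (l : ℕ)) * compat p l ^ (b - 1)) := by ring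
    _ ≤ E * H := by gcongr

/-- For `i ≤ k` every spin forbidden next to `i` exceeds `k`, so only the terms controlled by `H`
occur. -/
theorem IsExtremalPair.low_gap_le (h : IsExtremalPair b lam p p') (h0 : 0 < lam)
    (h1 : lam ≤ 1 / 2) (hb : 0 < b) (hC : C = 2 * k) (hE : 0 ≤ E) (hH0 : 0 ≤ H)
    (hH : ∀ i, k < i → i ≤ C → b * lam ^ (C + 1 - i) * compat p i ^ (b - 1) ≤ H)
    (hgap : ∀ i, k < i → i ≤ C → compat p i - compat p' i ≤ E * lam ^ (C + 1 - i))
    {i : ℕ} (hi : i ≤ k) : compat p i - compat p' i ≤ 2 * (E * H) * lam ^ (C + 1 - i) := by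
  refine (h.gap_le h0 hb i).trans ?_
  have htail := sum_tail_le (C := C) h0 (by linarith) (C + 1 - i)
  have h2 : lam ^ (C + 1 - i) / (1 - lam) ≤ 2 * lam ^ (C + 1 - i) := by
    rw [div_le_iff₀ (by linarith)]
    have : 0 < lam ^ (C + 1 - i) := by positivity
    nlinarith
  calc _ ≤ ∑ l : Fin (C + 1), (if C + 1 - i ≤ (l : ℕ) then lam ^ (l : ℕ) else 0) * (E * H) := by
        refine Finset.sum_le_sum fun l _ => ?_
        by_cases hl : C < i + (l : ℕ)
        · rw [if_pos hl, if_pos (by omega)]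
          exact mul_le_mul_of_nonneg_left (h.high_term_le hE hH hgap l (by omega))
            (by positivity)
        · rw [if_neg hl, if_neg (by omega), zero_mul]
    _ ≤ (2 * lam ^ (C + 1 - i)) * (E * H) := by
        rw [← Finset.sum_mul]
        exact mul_le_mul_of_nonneg_right (htail.trans h2) (mul_nonneg hE hH0)
    _ = _ := by ring

/-- Next to `i > k` some forbidden spins may be at most `k`. For these the bound of `low_gap_le` is
fed back, at the price of `b * lam ^ (k + 1)`; the forbidden spins above `k` bring a spare factor
`lam`. -/
theorem IsExtremalPair.high_gap_le (h : IsExtremalPair b lam p p') (h0 : 0 < lam)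
    (h1 : lam ≤ 1 / 2) (hb : 0 < b) (hC : C = 2 * k) (hE : 0 ≤ E) (hH0 : 0 ≤ H)
    (hH : ∀ i, k < i → i ≤ C → b * lam ^ (C + 1 - i) * compat p i ^ (b - 1) ≤ H)
    (hgap : ∀ i, k < i → i ≤ C → compat p i - compat p' i ≤ E * lam ^ (C + 1 - i))
    {i : ℕ} (hi : k < i) (hiC : i ≤ C) :
    compat p i - compat p' i
      ≤ (4 * (b * lam ^ (k + 1)) + 2 * lam) * H * E * lam ^ (C + 1 - i) := by
  refine (h.gap_le h0 hb i).trans ?_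
  have htwo : ∀ m, lam ^ m / (1 - lam) ≤ 2 * lam ^ m := fun m => by
    rw [div_le_iff₀ (by linarith)]
    have : 0 < lam ^ m := by positivity
    nlinarith
  have ht1 := (sum_tail_le (C := C) h0 (by linarith) (C + 1 - i)).trans (htwo _)
  have ht2 := (sum_tail_le (C := C) h0 (by linarith) (k + 1)).trans (htwo _)
  have hEH : 0 ≤ E * H := mul_nonneg hE hH0
  have hpow : lam ^ (k + 1) ≤ lam * lam ^ (C + 1 - i) := by
    rw [← pow_succ']
    exact pow_le_pow_of_le_one h0.le (by linarith) (by omega)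
  have hA : 0 ≤ b * lam ^ (k + 1) := by positivity
  calc _ ≤ ∑ l : Fin (C + 1), ((if C + 1 - i ≤ (l : ℕ) then lam ^ (l : ℕ) else 0)
          * (2 * (b * lam ^ (k + 1)) * (E * H))
          + (if k + 1 ≤ (l : ℕ) then lam ^ (l : ℕ) else 0) * (E * H)) := by
        refine Finset.sum_le_sum fun l _ => ?_
        by_cases hl : C < i + (l : ℕ)
        · rw [if_pos hl, if_pos (by omega)]
          by_cases hlk : k < (l : ℕ)
          · rw [if_pos (show k + 1 ≤ (l : ℕ) from hlk)]
            have := mul_le_mul_of_nonneg_left (h.high_term_le hE hH hgap l hlk)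
              (pow_nonneg h0.le (l : ℕ))
            have h3 : 0 ≤ lam ^ (l : ℕ) * (2 * (b * lam ^ (k + 1)) * (E * H)) := by positivity
            linarith
          · rw [if_neg (by omega), zero_mul, add_zero]
            refine mul_le_mul_of_nonneg_left ?_ (by positivity)
            have h3 := h.low_gap_le h0 h1 hb hC hE hH0 hH hgap (i := l) (by omega)
            have h4 : lam ^ (C + 1 - (l : ℕ)) ≤ lam ^ (k + 1) :=
              pow_le_pow_of_le_one h0.le (by linarith) (by omega)
            have h5 : compat p l ^ (b - 1) ≤ 1 :=
              pow_le_one₀ (compat_nonneg h.mem.1 _) (compat_le_one h.mem _)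
            have h6 : 0 ≤ compat p l - compat p' l := sub_nonneg.2 (h.compat_le _)
            calc b * (compat p l - compat p' l) * compat p l ^ (b - 1)
                ≤ b * (compat p l - compat p' l) :=
                  mul_le_of_le_one_right (by positivity) h5
              _ ≤ b * (2 * (E * H) * lam ^ (k + 1)) :=
                  mul_le_mul_of_nonneg_left (h3.trans (mul_le_mul_of_nonneg_left h4
                    (by positivity))) (by positivity)
              _ = _ := by ring
        · rw [if_neg hl, if_neg (by omega), zero_mul, zero_add]
          split_ifs
          · positivity
          · simp
    _ ≤ (2 * lam ^ (C + 1 - i)) * (2 * (b * lam ^ (k + 1)) * (E * H))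
          + (2 * lam ^ (k + 1)) * (E * H) := by
        rw [Finset.sum_add_distrib, ← Finset.sum_mul, ← Finset.sum_mul]
        gcongr
    _ ≤ (2 * lam ^ (C + 1 - i)) * (2 * (b * lam ^ (k + 1)) * (E * H))
          + (2 * (lam * lam ^ (C + 1 - i))) * (E * H) := by gcongr
    _ = _ := by ring

/-- The contraction criterion: if large spins are very unlikely next to allowed small ones, then the
two extremal laws coincide. -/
theorem IsExtremalPair.eq_of_contraction (h : IsExtremalPair b lam p p') (h0 : 0 < lam)
    (h1 : lam ≤ 1 / 2) (hb : 0 < b) (hC : C = 2 * k) (hH0 : 0 ≤ H)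
    (hH : ∀ i, k < i → i ≤ C → b * lam ^ (C + 1 - i) * compat p i ^ (b - 1) ≤ H)
    (hsmall : (4 * (b * lam ^ (k + 1)) + 2 * lam) * H ≤ 1 / 2) : p = p' := by
  -- The factor `1 / lam ^ (C + 1)` makes the case `n = 0` a consequence of the trivial bound `1` on
  -- the gap.
  have hiter : ∀ n : ℕ, ∀ i, k < i → i ≤ C →
      compat p i - compat p' i ≤ (1 / 2) ^ n * (1 / lam ^ (C + 1)) * lam ^ (C + 1 - i) := by
    intro n
    induction n with
    | zero =>
      intro i _ _
      have h2 := compat_le_one h.mem i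
      have h3 := compat_nonneg h.mem'.1 i
      have h4 : lam ^ (C + 1) ≤ lam ^ (C + 1 - i) :=
        pow_le_pow_of_le_one h0.le (by linarith) (by omega)
      rw [pow_zero, one_mul, one_div_mul_eq_div]
      have : 1 ≤ lam ^ (C + 1 - i) / lam ^ (C + 1) := by
        rwa [le_div_iff₀ (by positivity), one_mul]
      linarith
    | succ n ih =>
      intro i hi hiC
      refine (h.high_gap_le h0 h1 hb hC (by positivity) hH0 hH ih hi hiC).trans ?_
      have h2 : 0 ≤ (1 / 2 : ℝ) ^ n * (1 / lam ^ (C + 1)) := by positivity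
      refine mul_le_mul_of_nonneg_right ((mul_le_mul_of_nonneg_right hsmall h2).trans_eq ?_)
        (by positivity)
      ring
  have hzero : ∀ i, k < i → i ≤ C → compat p i - compat p' i ≤ 0 * lam ^ (C + 1 - i) := by
    intro i hi hiC
    rw [zero_mul]
    have ht : Tendsto (fun n : ℕ => (1 / 2 : ℝ) ^ n * (1 / lam ^ (C + 1)) * lam ^ (C + 1 - i))
        atTop (𝓝 0) := by
      have := ((tendsto_pow_atTop_nhds_zero_of_lt_one (r := (1 / 2 : ℝ)) (by norm_num)
        (by norm_num)).mul_const (1 / lam ^ (C + 1))).mul_const (lam ^ (C + 1 - i))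
      simpa only [zero_mul] using this
    exact ge_of_tendsto' ht fun n => hiter n i hi hiC
  have hall : ∀ i, compat p i = compat p' i := by
    intro i
    refine le_antisymm ?_ (h.compat_le i)
    rcases le_or_gt i k with hik | hik
    · have := h.low_gap_le h0 h1 hb hC le_rfl hH0 hH hzero hik
      simpa using this
    · rcases le_or_gt i C with hiC | hiC
      · have := hzero i hik hiC
        simpa using this
      · rw [compat, compat, Finset.sum_eq_zero fun l _ => if_neg (by omega),
          Finset.sum_eq_zero fun l _ => if_neg (by omega)]
  funext j
  rw [eq_compat_sub p, eq_compat_sub p', hall, hall]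

/-- Spin `C + 1 - i` is forbidden next to `i` and is at most `k`, so its children, of law `p'`, are
all compatible with it with probability at least `G`. It therefore has mass at least `(1 - lam) *
lam ^ (C + 1 - i) * G` under `p`. The `4` comes from `1 - lam ≥ 1 / 2` and `b - 1 ≥ b / 2`. -/
theorem IsExtremalPair.compat_pow_le (h : IsExtremalPair b lam p p') (h0 : 0 < lam)
    (h1 : lam ≤ 1 / 2) (hb : 2 ≤ b) (hC : C = 2 * k) {G : ℝ} (hG : G ≤ compat p' k ^ b)
    {i : ℕ} (hi : k < i) (hiC : i ≤ C) :
    compat p i ^ (b - 1) ≤ Real.exp (-(b * lam ^ (C + 1 - i) * G / 4)) := by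
  rcases le_or_gt G 0 with hG0 | hG0
  · refine (pow_le_one₀ (compat_nonneg h.mem.1 _) (compat_le_one h.mem _)).trans ?_
    rw [Real.one_le_exp_iff]
    have : (0 : ℝ) < b * lam ^ (C + 1 - i) := by positivity
    nlinarith
  have h2 := compat_homStep_le (b := b) h0 (by linarith) h.mem' (i := i) (j := C + 1 - i) (by omega)
    (by omega)
  rw [h.step_eq'] at h2
  have h3 : G ≤ compat p' (C + 1 - i) ^ b :=
    hG.trans (pow_le_pow_left₀ (compat_nonneg h.mem'.1 _) (compat_antitone h.mem'.1 (by omega)) _)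
  have h4 : lam ^ (C + 1 - i) * G / 2
      ≤ (1 - lam) * (lam ^ (C + 1 - i) * compat p' (C + 1 - i) ^ b) := by
    have h5 : lam ^ (C + 1 - i) * G ≤ lam ^ (C + 1 - i) * compat p' (C + 1 - i) ^ b := by gcongr
    have h6 : 0 < lam ^ (C + 1 - i) * G := by positivity
    nlinarith
  have h5 : compat p i ≤ Real.exp (-(lam ^ (C + 1 - i) * G / 2)) := by
    have := Real.add_one_le_exp (-(lam ^ (C + 1 - i) * G / 2))
    linarith
  refine (pow_le_pow_left₀ (compat_nonneg h.mem.1 _) h5 _).trans ?_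
  rw [← Real.exp_nat_mul, Real.exp_le_exp]
  have hb1 : (b : ℝ) / 2 ≤ ((b - 1 : ℕ) : ℝ) := by
    rw [Nat.cast_sub (by omega)]
    have : (2 : ℝ) ≤ b := by exact_mod_cast hb
    push_cast
    linarith
  have h6 : 0 ≤ lam ^ (C + 1 - i) * G := by positivity
  nlinarith

end Contraction

/-! ### Numerical inequalities for large branching number -/

/-- The exponent of `b` in the estimates for `C = 2 * k`. -/
noncomputable def rate (k : ℕ) : ℝ := 1 / (8 * ((k : ℝ) + 1))

theorem rate_pos (k : ℕ) : 0 < rate k := by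
  unfold rate
  positivity

/-- The inequalities that make the branching number `b` large enough. -/
structure LargeDegree (k b : ℕ) : Prop where
  two_le : 2 ≤ b
  one_le_log : 1 ≤ Real.log b
  log_le : 3 * Real.log b ≤ (b : ℝ) ^ (1 / 8 : ℝ)
  rpow_le : (b : ℝ) ^ (-(7 * rate k)) ≤ 1 / 100
  rpow_le_exp : (b : ℝ) ^ (-(6 * rate k)) ≤ Real.exp (-2)
  contraction : (12 * Real.log b + 2) * (b * Real.exp (-((b : ℝ) ^ rate k / 400))) ≤ 1 / 2
  exp_le : Real.exp (-((b : ℝ) ^ rate k / 800)) ≤ 1 / (2 * b)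
  rpow_le' : (b : ℝ) ^ (-(3 / 16 : ℝ)) ≤ 1 / 16

theorem eventually_largeDegree (k : ℕ) : ∀ᶠ b : ℕ in atTop, LargeDegree k b := by
  have hr := rate_pos k
  have hcast := tendsto_natCast_atTop_atTop (R := ℝ)
  have hlog := Real.tendsto_log_atTop.comp hcast
  have hneg : ∀ s : ℝ, 0 < s → Tendsto (fun b : ℕ => (b : ℝ) ^ (-s)) atTop (𝓝 0) := fun s hs =>
    (tendsto_rpow_neg_atTop hs).comp hcast
  have hlogle : ∀ᶠ b : ℕ in atTop, 3 * Real.log b ≤ (b : ℝ) ^ (1 / 8 : ℝ) := by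
    have := (isLittleO_log_rpow_atTop (r := (1 / 8 : ℝ)) (by norm_num)).bound
      (c := 1 / 3) (by norm_num)
    filter_upwards [hcast.eventually this, eventually_ge_atTop 1] with b hb hb1
    have h1 : (0 : ℝ) ≤ Real.log b := Real.log_natCast_nonneg b
    rw [Real.norm_of_nonneg h1, Real.norm_of_nonneg (by positivity)] at hb
    linarith
  have hexp : ∀ c : ℝ, 0 < c →
      Tendsto (fun b : ℕ => (b : ℝ) ^ (2 : ℝ) * Real.exp (-((b : ℝ) ^ rate k * c))) atTop
        (𝓝 0) := by
    intro c hc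
    -- In the variable `y = b ^ rate k` the factor `b ^ 2` is the power `y ^ (2 / rate k)`.
    have h1 := (tendsto_rpow_mul_exp_neg_mul_atTop_nhds_zero (2 / rate k) c hc).comp
      ((tendsto_rpow_atTop hr).comp hcast)
    refine h1.congr fun b => ?_
    simp only [Function.comp_apply]
    rw [← Real.rpow_mul (Nat.cast_nonneg b), mul_div_cancel₀ _ hr.ne']
    ring_nf
  have h400 : ∀ᶠ b : ℕ in atTop, (b : ℝ) ^ (2 : ℝ) * Real.exp (-((b : ℝ) ^ rate k * (1 / 400)))
      ≤ 1 / 28 := (hexp _ (by norm_num)).eventually_le_const (by norm_num)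
  have h800 : ∀ᶠ b : ℕ in atTop, (b : ℝ) ^ (2 : ℝ) * Real.exp (-((b : ℝ) ^ rate k * (1 / 800)))
      ≤ 1 / 2 := (hexp _ (by norm_num)).eventually_le_const (by norm_num)
  filter_upwards [eventually_ge_atTop 2, hlog.eventually_ge_atTop 1, hlogle,
    (hneg (7 * rate k) (by positivity)).eventually_le_const (show (0 : ℝ) < 1 / 100 by norm_num),
    (hneg (6 * rate k) (by positivity)).eventually_le_const (Real.exp_pos (-2)), h400, h800,
    (hneg (3 / 16) (by norm_num)).eventually_le_const (show (0 : ℝ) < 1 / 16 by norm_num)]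
    with b h1 h2 h3 h4 h5 h6 h7 h8
  have hb : (2 : ℝ) ≤ b := by exact_mod_cast h1
  simp only [Real.rpow_two, mul_one_div] at h6 h7
  refine ⟨h1, h2, h3, h4, h5, ?_, ?_, h8⟩
  · have h9 : Real.log b ≤ b := Real.log_le_self (by positivity)
    calc (12 * Real.log b + 2) * (b * Real.exp (-((b : ℝ) ^ rate k / 400)))
        ≤ (14 * b) * (b * Real.exp (-((b : ℝ) ^ rate k / 400))) := by
          gcongr
          linarith
      _ = 14 * ((b : ℝ) ^ 2 * Real.exp (-((b : ℝ) ^ rate k / 400))) := by ring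
      _ ≤ 1 / 2 := by linarith
  · rw [le_div_iff₀ (by positivity)]
    have h9 : (b : ℝ) ≤ (b : ℝ) ^ 2 := by nlinarith
    have := mul_le_mul_of_nonneg_right h9 (Real.exp_pos (-((b : ℝ) ^ rate k / 800))).le
    linarith

theorem LargeDegree.cast_pos (hL : LargeDegree k b) : (0 : ℝ) < b := by
  have := hL.two_le
  positivity

/-- The logarithm costs at most `b ^ (1 / 8)`, hence `lam ^ (k + 1) ≤ b ^ (-7 / 8)`, and `7 * rate
k` is `7 / 8` divided by `k + 1`. -/
theorem LargeDegree.lam_le_rpow (hL : LargeDegree k b)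
    (hlam : b * lam ^ (k + 1) ≤ 3 * Real.log b) : lam ≤ (b : ℝ) ^ (-(7 * rate k)) := by
  have hb := hL.cast_pos
  have h1 : lam ^ (k + 1) ≤ (b : ℝ) ^ (-(7 / 8 : ℝ)) := by
    have h2 : (b : ℝ) ^ (1 / 8 : ℝ) = b * (b : ℝ) ^ (-(7 / 8 : ℝ)) := by
      rw [← Real.rpow_one_add' hb.le (by norm_num)]
      norm_num
    have := hlam.trans hL.log_le
    rw [h2] at this
    exact le_of_mul_le_mul_left this hb
  have h3 : (b : ℝ) ^ (-(7 / 8 : ℝ)) = ((b : ℝ) ^ (-(7 * rate k))) ^ (k + 1) := by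
    rw [← Real.rpow_mul_natCast hb.le]
    congr 1
    unfold rate
    push_cast
    field_simp
  rw [h3] at h1
  exact le_of_pow_le_pow_left₀ (Nat.succ_ne_zero k) (by positivity) h1

theorem LargeDegree.lam_le (hL : LargeDegree k b)
    (hlam : b * lam ^ (k + 1) ≤ 3 * Real.log b) : lam ≤ 1 / 100 :=
  (hL.lam_le_rpow hlam).trans hL.rpow_le

/-- In the window, the expected number of children in the middle state is a power of `b`, even
after a penalty of `b ^ (-6 * rate k)`. -/
theorem LargeDegree.rpow_le_mul (hL : LargeDegree k b) (h0 : 0 < lam)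
    (hlam : b * lam ^ (k + 1) ≤ 3 * Real.log b) (hlow : 1 / 100 ≤ b * lam ^ (k + 1)) :
    (b : ℝ) ^ rate k / 100 ≤ b * lam ^ k * (b : ℝ) ^ (-(6 * rate k)) := by
  have hb := hL.cast_pos
  have h1 := hL.lam_le_rpow hlam
  -- Dividing `b * lam ^ (k + 1)` by `lam` gains the exponent `7 * rate k`; six parts pay the
  -- penalty and one remains.
  have h2 : (b : ℝ) ^ rate k * (b : ℝ) ^ (-(7 * rate k)) = (b : ℝ) ^ (-(6 * rate k)) := by
    rw [← Real.rpow_add hb]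
    congr 1
    ring
  have h3 : 1 / 100 ≤ b * lam ^ k * (b : ℝ) ^ (-(7 * rate k)) := by
    refine hlow.trans ?_
    rw [pow_succ, ← mul_assoc]
    gcongr
  rw [← h2]
  have h4 : 0 < (b : ℝ) ^ rate k := by positivity
  nlinarith

theorem exp_neg_le_one_sub {x : ℝ} (hx : x < 1) : Real.exp (-(x / (1 - x))) ≤ 1 - x := by
  have h1 : 0 < 1 - x := by linarith
  have h2 := Real.add_one_le_exp (x / (1 - x))
  have h3 : x / (1 - x) + 1 = (1 - x)⁻¹ := by
    field_simp
    ring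
  rw [h3] at h2
  rw [Real.exp_neg]
  exact inv_le_of_inv_le₀ h1 h2

theorem LargeDegree.le_pow_of_one_sub_le (hL : LargeDegree k b) {g : ℝ} (hg : 1 - g ≤ 1 / b) :
    (b : ℝ) ^ (-(6 * rate k)) ≤ g ^ b := by
  have hb := hL.cast_pos
  have hb2 : (2 : ℝ) ≤ b := by exact_mod_cast hL.two_le
  have h1 : (1 : ℝ) / b ≤ 1 / 2 := one_div_le_one_div_of_le (by norm_num) hb2
  have h2 := exp_neg_le_one_sub (x := 1 / (b : ℝ)) (by linarith)
  have h3 : 1 / (b : ℝ) / (1 - 1 / b) ≤ 2 / b := by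
    rw [div_le_iff₀ (by linarith)]
    have : 2 / (b : ℝ) * (1 - 1 / b) = 1 / b * (2 * (1 - 1 / b)) := by ring
    rw [this]
    have h4 : 0 < 1 / (b : ℝ) := by positivity
    nlinarith
  have h4 : Real.exp (-(2 / b)) ≤ g :=
    (Real.exp_le_exp.2 (neg_le_neg h3)).trans (h2.trans (by linarith))
  have h5 := pow_le_pow_left₀ (Real.exp_pos _).le h4 b
  rw [← Real.exp_nat_mul] at h5
  have h6 : (b : ℝ) * -(2 / b) = -2 := by field_simp
  rw [h6] at h5
  exact hL.rpow_le_exp.trans h5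

/-! ### The dichotomy and the two ends of the window -/

section

variable {p p' : Fin (C + 1) → ℝ}

theorem IsExtremalPair.one_sub_compat_le (h : IsExtremalPair b lam p p') (h0 : 0 < lam)
    (h1 : lam < 1) (hC : C = 2 * k) : 1 - compat p' k ≤ lam ^ (k + 1) / (1 - lam) := by
  have := one_sub_compat_homStep_le (b := b) h0 h1 h.mem (i := k) (by omega)
  rw [h.step_eq, show C + 1 - k = k + 1 by omega] at this
  refine this.trans (mul_le_of_le_one_right (div_nonneg (by positivity) (by linarith)) ?_)
  exact pow_le_one₀ (compat_nonneg h.mem.1 _) (compat_le_one h.mem _)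

/-- Bernoulli's inequality allows `G = 1 / 2`, so `H` can be a constant, and the prefactor in the
contraction criterion supplies the smallness. -/
theorem IsExtremalPair.eq_of_small (h : IsExtremalPair b lam p p') (hL : LargeDegree k b)
    (h0 : 0 < lam) (hC : C = 2 * k) (hlam : b * lam ^ (k + 1) ≤ 1 / 100) : p = p' := by
  have hb := hL.cast_pos
  have hl := hL.lam_le (hlam.trans (by linarith [hL.one_le_log]))
  have hG : 1 / 2 ≤ compat p' k ^ b := by
    have h2 := h.one_sub_compat_le h0 (by linarith) hC
    have h3 : lam ^ (k + 1) / (1 - lam) ≤ 2 * lam ^ (k + 1) := by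
      rw [div_le_iff₀ (by linarith)]
      have : 0 < lam ^ (k + 1) := by positivity
      nlinarith
    have h4 : -2 ≤ -(1 - compat p' k) := by linarith [compat_nonneg h.mem'.1 k]
    have h5 := one_add_mul_le_pow h4 b
    have h6 : b * (1 - compat p' k) ≤ b * (2 * lam ^ (k + 1)) :=
      mul_le_mul_of_nonneg_left (h2.trans h3) hb.le
    have h7 : 1 + -(1 - compat p' k) = compat p' k := by ring
    rw [h7] at h5
    linarith
  -- `8` bounds `y * exp (-y / 8)` for every `y`, and `(4 / 100 + 2 / 100) * 8 < 1 / 2`.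
  refine h.eq_of_contraction (H := 8) h0 (by linarith) (by exact_mod_cast hb) hC (by norm_num)
    (fun i hi hiC => ?_) (by linarith)
  have h2 := h.compat_pow_le h0 (by linarith) hL.two_le hC hG hi hiC
  have h3 : 0 < b * lam ^ (C + 1 - i) := by positivity
  refine (mul_le_mul_of_nonneg_left h2 h3.le).trans ?_
  set y := b * lam ^ (C + 1 - i)
  have h4 := Real.add_one_le_exp (y * (1 / 2) / 4)
  have h5 : Real.exp (y * (1 / 2) / 4) * Real.exp (-(y * (1 / 2) / 4)) = 1 := by
    rw [← Real.exp_add, add_neg_cancel, Real.exp_zero]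
  have h6 := Real.exp_pos (-(y * (1 / 2) / 4))
  nlinarith

/-- By `LargeDegree.rpow_le_mul` the exponent in `compat_pow_le` is at least a power of `b`, which
beats the factor `b` and the logarithmic prefactor. -/
theorem IsExtremalPair.eq_of_rpow_le (h : IsExtremalPair b lam p p') (hL : LargeDegree k b)
    (h0 : 0 < lam) (hC : C = 2 * k) (hlam : b * lam ^ (k + 1) ≤ 3 * Real.log b)
    (hG : (b : ℝ) ^ (-(6 * rate k)) ≤ compat p' k ^ b) : p = p' := by
  rcases le_total (b * lam ^ (k + 1)) (1 / 100) with hlow | hlow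
  · exact h.eq_of_small hL h0 hC hlow
  have hb := hL.cast_pos
  have hl := hL.lam_le hlam
  have hr := hL.rpow_le_mul h0 hlam hlow
  refine h.eq_of_contraction (H := b * Real.exp (-((b : ℝ) ^ rate k / 400))) h0 (by linarith)
    (by exact_mod_cast hb) hC (by positivity) (fun i hi hiC => ?_) ?_
  · have h2 := h.compat_pow_le h0 (by linarith) hL.two_le hC hG hi hiC
    have h3 : b * lam ^ (C + 1 - i) ≤ b :=
      mul_le_of_le_one_right hb.le (pow_le_one₀ h0.le (by linarith))
    refine mul_le_mul h3 (h2.trans (Real.exp_le_exp.2 ?_))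
      (pow_nonneg (compat_nonneg h.mem.1 _) _) hb.le
    have h4 : lam ^ k ≤ lam ^ (C + 1 - i) := pow_le_pow_of_le_one h0.le (by linarith) (by omega)
    have h5 : b * lam ^ k * (b : ℝ) ^ (-(6 * rate k))
        ≤ b * lam ^ (C + 1 - i) * (b : ℝ) ^ (-(6 * rate k)) := by gcongr
    linarith
  · refine le_trans ?_ hL.contraction
    gcongr ?_ * _
    linarith

/-- The mass of `p'` above `k` is at most `lam ^ (k + 1) / (1 - lam)`, so `compat p' k ^ b` is at
least `exp (-(3 / 2) * b * lam ^ (k + 1))`. At the lower end of the window this bound is exactly `b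
^ (-(6 * rate k))`. -/
theorem IsExtremalPair.eq_of_lt_window (h : IsExtremalPair b lam p p') (hL : LargeDegree k b)
    (h0 : 0 < lam) (hC : C = 2 * k) (hlam : b * lam ^ (k + 1) ≤ Real.log b / (2 * (k + 1))) :
    p = p' := by
  have hb := hL.cast_pos
  have hlog := hL.one_le_log
  have h1 : Real.log b / (2 * (k + 1)) ≤ 3 * Real.log b := by
    rw [div_le_iff₀ (by positivity)]
    have : (0 : ℝ) ≤ k := Nat.cast_nonneg k
    nlinarith
  have hlam' := hlam.trans h1
  have hl := hL.lam_le hlam'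
  refine h.eq_of_rpow_le hL h0 hC hlam' ?_
  set x := 1 - compat p' k with hx
  have hx0 : 0 ≤ x := sub_nonneg.2 (compat_le_one h.mem' k)
  have h2 : x ≤ lam ^ (k + 1) / (1 - lam) := h.one_sub_compat_le h0 (by linarith) hC
  have hpow : 0 < lam ^ (k + 1) := by positivity
  have hpow1 : lam ^ (k + 1) ≤ lam := pow_le_of_le_one h0.le (by linarith) (Nat.succ_ne_zero k)
  rw [le_div_iff₀ (by linarith)] at h2
  have hx1 : x ≤ 1 / 50 := by nlinarith
  have h3 : x / (1 - x) ≤ 3 / 2 * lam ^ (k + 1) := by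
    rw [div_le_iff₀ (by linarith)]
    nlinarith
  have h4 := exp_neg_le_one_sub (x := x) (by linarith)
  have h5 : Real.exp (-(3 / 2 * lam ^ (k + 1))) ≤ compat p' k :=
    (Real.exp_le_exp.2 (neg_le_neg h3)).trans (h4.trans (by rw [hx]; linarith))
  refine le_trans ?_ (pow_le_pow_left₀ (Real.exp_pos _).le h5 b)
  rw [← Real.exp_nat_mul, Real.rpow_def_of_pos hb, Real.exp_le_exp]
  have h6 : Real.log b * -(6 * rate k) = -(3 / 2) * (Real.log b / (2 * (k + 1))) := by
    unfold rate
    field_simp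
    norm_num
  rw [h6]
  linarith

/-- One double step of the recursion keeps the spins above `C / 2` extremely unlikely. -/
theorem one_sub_compat_double_step (hL : LargeDegree k b) (h0 : 0 < lam) (hC : C = 2 * k)
    (hlam : b * lam ^ (k + 1) ≤ 3 * Real.log b) (hlow : 1 / 100 ≤ b * lam ^ (k + 1))
    {r : Fin (C + 1) → ℝ} (hr : r ∈ laws C) (hr1 : 1 - compat r k ≤ 1 / b) :
    1 - compat (homStep b lam (homStep b lam r)) k ≤ Real.exp (-((b : ℝ) ^ rate k / 800)) := by
  have hb := hL.cast_pos
  have hl := hL.lam_le hlam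
  have hm := homStep_mem (b := b) h0 hr
  have hG := hL.le_pow_of_one_sub_le hr1
  have hR := hL.rpow_le_mul h0 hlam hlow
  have h1 := one_sub_compat_homStep_le (b := b) h0 (by linarith) hm (i := k) (by omega)
  rw [show C + 1 - k = k + 1 by omega] at h1
  -- If `r` rarely exceeds `k`, one step gives spin `k` mass of order `lam ^ k`, up to the penalty.
  -- At the next step a vertex above `k` would need all `b` children to stay below `k`.
  have h2 := compat_homStep_le (b := b) h0 (by linarith) hr (i := k + 1) (j := k) (by omega)
    (by omega)
  have h3 : lam ^ k * (b : ℝ) ^ (-(6 * rate k)) / 2 ≤ (1 - lam) * (lam ^ k * compat r k ^ b) := by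
    have h5 : lam ^ k * (b : ℝ) ^ (-(6 * rate k)) ≤ lam ^ k * compat r k ^ b := by gcongr
    have h6 : 0 < lam ^ k * (b : ℝ) ^ (-(6 * rate k)) := by positivity
    nlinarith
  have h4 : compat (homStep b lam r) (k + 1)
      ≤ Real.exp (-(lam ^ k * (b : ℝ) ^ (-(6 * rate k)) / 2)) := by
    have := Real.add_one_le_exp (-(lam ^ k * (b : ℝ) ^ (-(6 * rate k)) / 2))
    linarith
  have h5 := pow_le_pow_left₀ (compat_nonneg hm.1 _) h4 b
  rw [← Real.exp_nat_mul] at h5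
  have h6 : lam ^ (k + 1) / (1 - lam) ≤ 1 := by
    rw [div_le_one (by linarith)]
    have : lam ^ (k + 1) ≤ lam := pow_le_of_le_one h0.le (by linarith) (Nat.succ_ne_zero k)
    linarith
  refine h1.trans ((mul_le_of_le_one_left (pow_nonneg (compat_nonneg hm.1 _) _) h6).trans
    (h5.trans (Real.exp_le_exp.2 ?_)))
  have : 0 < (b : ℝ) ^ rate k := by positivity
  linarith

/-- The double step returns a bound smaller than the `1 / b` it requires, so it propagates along the
even iterates from the point mass at `0`. -/
theorem IsExtremalPair.one_sub_compat_low_le (h : IsExtremalPair b lam p p')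
    (hL : LargeDegree k b) (h0 : 0 < lam) (hC : C = 2 * k)
    (hlam : b * lam ^ (k + 1) ≤ 3 * Real.log b) (hlow : 1 / 100 ≤ b * lam ^ (k + 1)) :
    1 - compat p k ≤ Real.exp (-((b : ℝ) ^ rate k / 800)) := by
  have hb := hL.cast_pos
  have hexp : Real.exp (-((b : ℝ) ^ rate k / 800)) ≤ 1 / b := by
    refine hL.exp_le.trans (one_div_le_one_div_of_le hb ?_)
    linarith
  have hiter : ∀ n, 1 - compat (iterLaw C b lam (2 * n)) k
      ≤ Real.exp (-((b : ℝ) ^ rate k / 800)) := by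
    intro n
    induction n with
    | zero =>
      have : compat (iterLaw C b lam (2 * 0)) k = 1 := by
        change compat (Pi.single 0 1 : Fin (C + 1) → ℝ) k = 1
        rw [compat_single, if_pos (by simp; omega)]
      rw [this, sub_self]
      exact (Real.exp_pos _).le
    | succ n ih =>
      have := one_sub_compat_double_step hL h0 hC hlam hlow (iterLaw_mem h0 (2 * n))
        (ih.trans hexp)
      rwa [← iterLaw_succ, ← iterLaw_succ] at this
  have hlim := (((continuous_compat (C := C) k).tendsto p).comp h.even).const_sub 1
  exact le_of_tendsto' hlim hiter

/-- The dichotomy between the two extremal laws. -/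
theorem IsExtremalPair.eq_or_lt_gap (h : IsExtremalPair b lam p p') (hL : LargeDegree k b)
    (h0 : 0 < lam) (hC : C = 2 * k) (hlam : b * lam ^ (k + 1) ≤ 3 * Real.log b) :
    p = p' ∨ 1 / b - Real.exp (-((b : ℝ) ^ rate k / 800)) < compat p k - compat p' k := by
  rcases le_total (b * lam ^ (k + 1)) (1 / 100) with hlow | hlow
  · exact Or.inl (h.eq_of_small hL h0 hC hlow)
  -- At mass `1 / b` above `k`, the `b` children all stay at or below `k` with probability bounded
  -- below. This is why the contraction covers everything up to that threshold.
  rcases le_or_gt (1 - compat p' k) (1 / b) with h1 | h1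
  · exact Or.inl (h.eq_of_rpow_le hL h0 hC hlam (hL.le_pow_of_one_sub_le h1))
  · right
    have := h.one_sub_compat_low_le hL h0 hC hlam hlow
    linarith

/-- At the upper end of the window the odd iterates keep a macroscopic mass above `C / 2`. -/
theorem IsExtremalPair.ne_of_log_eq (h : IsExtremalPair b lam p p') (hL : LargeDegree k b)
    (h0 : 0 < lam) (hk : 1 ≤ k) (hC : C = 2 * k) (hlam : b * lam ^ (k + 1) = Real.log b) :
    p ≠ p' := by
  have hb := hL.cast_pos
  have hlog := hL.one_le_log
  have hlam' : b * lam ^ (k + 1) ≤ 3 * Real.log b := by linarith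
  have hl := hL.lam_le hlam'
  have hpow : lam ^ (k + 1) = Real.log b / b := by
    rw [eq_div_iff hb.ne']
    linarith
  -- Since `k ≥ 1`, `7 * rate k * k` is at least `7 / 16`, which exceeds the `1 / 4` left over from
  -- `b * b ^ (-3 / 4)`.
  have hlk : 2 * lam ^ k * (b : ℝ) ^ (1 / 4 : ℝ) ≤ 1 / 8 := by
    have h1 := hL.lam_le_rpow hlam'
    have h2 : lam ^ k ≤ (b : ℝ) ^ (-(7 / 16 : ℝ)) := by
      refine (pow_le_pow_left₀ h0.le h1 k).trans ?_
      rw [← Real.rpow_mul_natCast hb.le]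
      refine Real.rpow_le_rpow_of_exponent_le
        (by exact_mod_cast (by omega : 1 ≤ 2).trans hL.two_le) ?_
      have hk1 : (1 : ℝ) ≤ k := by exact_mod_cast hk
      have : rate k * k = k / (8 * (k + 1)) := by
        unfold rate
        ring
      have h3 : (1 : ℝ) / 16 ≤ rate k * k := by
        rw [this, le_div_iff₀ (by positivity)]
        linarith
      linarith
    have h3 : (b : ℝ) ^ (-(7 / 16 : ℝ)) * (b : ℝ) ^ (1 / 4 : ℝ) = (b : ℝ) ^ (-(3 / 16 : ℝ)) := by
      rw [← Real.rpow_add hb]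
      norm_num
    have h4 : lam ^ k * (b : ℝ) ^ (1 / 4 : ℝ) ≤ (b : ℝ) ^ (-(3 / 16 : ℝ)) := by
      rw [← h3]
      gcongr
    linarith [hL.rpow_le']
  have hstep : ∀ r ∈ laws C, 7 / 8 ≤ compat r (k + 1) ^ b →
      3 / 4 * (Real.log b / b) ≤ 1 - compat (homStep b lam r) k := by
    intro r hr h1
    have h2 := compat_homStep_le (b := b) h0 (by linarith) hr (i := k) (j := k + 1) (by omega)
      (by omega)
    rw [← hpow]
    have h3 : 0 < lam ^ (k + 1) := by positivity
    have h4 : lam ^ (k + 1) * (7 / 8) ≤ lam ^ (k + 1) * compat r (k + 1) ^ b := by gcongr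
    nlinarith
  -- The bound reproduces itself over two steps. Mass `3 / 4 * log b / b` above `k` makes `compat r
  -- k ^ b` at most `b ^ (-3 / 4)`, so the next law rarely reaches `k`; the law after that then
  -- regains almost all of `lam ^ (k + 1) = log b / b`.
  have hiter : ∀ n, 3 / 4 * (Real.log b / b) ≤ 1 - compat (iterLaw C b lam (2 * n + 1)) k := by
    intro n
    induction n with
    | zero =>
      rw [iterLaw_succ]
      refine hstep _ (iterLaw_mem h0 _) ?_
      have : compat (iterLaw C b lam (2 * 0)) (k + 1) = 1 := by
        change compat (Pi.single 0 1 : Fin (C + 1) → ℝ) (k + 1) = 1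
        rw [compat_single, if_pos (by simp; omega)]
      rw [this, one_pow]
      norm_num
    | succ n ih =>
      rw [show 2 * (n + 1) + 1 = 2 * n + 1 + 1 + 1 by ring, iterLaw_succ]
      refine hstep _ (iterLaw_mem h0 _) ?_
      set r := iterLaw C b lam (2 * n + 1)
      have hr : r ∈ laws C := iterLaw_mem h0 _
      have h1 : compat r k ^ b ≤ (b : ℝ) ^ (-(3 / 4 : ℝ)) := by
        have h2 : compat r k ≤ Real.exp (-(3 / 4 * (Real.log b / b))) := by
          have := Real.add_one_le_exp (-(3 / 4 * (Real.log b / b)))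
          linarith
        refine (pow_le_pow_left₀ (compat_nonneg hr.1 _) h2 b).trans (le_of_eq ?_)
        rw [← Real.exp_nat_mul, Real.rpow_def_of_pos hb]
        congr 1
        field_simp
      have h2 := one_sub_compat_homStep_le (b := b) h0 (by linarith) hr (i := k + 1) (by omega)
      rw [show C + 1 - (k + 1) = k by omega, ← iterLaw_succ] at h2
      have hm : iterLaw C b lam (2 * n + 1 + 1) ∈ laws C := iterLaw_mem h0 _
      set g := compat (iterLaw C b lam (2 * n + 1 + 1)) (k + 1)
      have h3 : lam ^ k / (1 - lam) ≤ 2 * lam ^ k := by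
        rw [div_le_iff₀ (by linarith)]
        have : 0 < lam ^ k := by positivity
        nlinarith
      have h4 : 1 - g ≤ 2 * lam ^ k * (b : ℝ) ^ (-(3 / 4 : ℝ)) :=
        h2.trans (mul_le_mul h3 h1 (pow_nonneg (compat_nonneg hr.1 _) _) (by positivity))
      have h5 : (b : ℝ) ^ (1 / 4 : ℝ) = b * (b : ℝ) ^ (-(3 / 4 : ℝ)) := by
        rw [← Real.rpow_one_add' hb.le (by norm_num)]
        norm_num
      have h6 : b * (1 - g) ≤ 1 / 8 := by
        refine le_trans (mul_le_mul_of_nonneg_left h4 hb.le) (le_trans (le_of_eq ?_) hlk)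
        rw [h5]
        ring
      have h7 : -2 ≤ -(1 - g) := by
        have : 0 ≤ g := compat_nonneg hm.1 _
        linarith
      have h8 := one_add_mul_le_pow h7 b
      rw [show 1 + -(1 - g) = g by ring] at h8
      linarith
  have hlim := (((continuous_compat (C := C) k).tendsto p').comp h.odd).const_sub 1
  have h1 := ge_of_tendsto' hlim hiter
  have h2 := h.one_sub_compat_low_le hL h0 hC hlam' (by linarith)
  rintro rfl
  have h3 := h1.trans (h2.trans hL.exp_le)
  have h4 : 1 / (2 * (b : ℝ)) = 1 / 2 * (1 / b) := by
    field_simp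
  have h5 : 1 / (b : ℝ) ≤ Real.log b / b := by gcongr
  have h6 : 0 < 1 / (b : ℝ) := by positivity
  linarith

end

/-! ### `m` and `rootGap` in terms of the extremal pair -/

theorem ballProb_last_gt (hC : C = 2 * k) (hb : 0 < b) (h0 : 0 < lam) (n : ℕ) :
    ballProb C b lam n (Fin.last C) {σ | C / 2 < (σ [] : ℕ)}
      = 1 - compat (iterLaw C b lam n) k := by
  rw [ballProb_eq_sum h0 n _ (fun i => C / 2 < (i : ℕ)), fieldLaw_last hb,
    one_sub_compat (iterLaw_mem h0 n)]
  refine Finset.sum_congr rfl fun i _ => if_congr ?_ rfl rfl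
  omega

theorem ballProb_zero_gt (hC : C = 2 * k) (h0 : 0 < lam) (n : ℕ) :
    ballProb C b lam n 0 {σ | C / 2 < (σ [] : ℕ)} = 1 - compat (iterLaw C b lam (n + 1)) k := by
  rw [ballProb_eq_sum h0 n _ (fun i => C / 2 < (i : ℕ)), fieldLaw_zero,
    one_sub_compat (iterLaw_mem h0 (n + 1))]
  refine Finset.sum_congr rfl fun i _ => if_congr ?_ rfl rfl
  omega

theorem m_eq_limsup (hC : C = 2 * k) (hb : 0 < b) (h0 : 0 < lam) :
    m C b lam = limsup (fun n =>
      compat (iterLaw C b lam (n + 1)) k - compat (iterLaw C b lam n) k) atTop := by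
  unfold m
  congr 1
  funext n
  rw [ballProb_last_gt hC hb h0, ballProb_zero_gt hC h0]
  ring

theorem IsExtremalPair.m_eq_zero {p p' : Fin (C + 1) → ℝ} (h : IsExtremalPair b lam p p')
    (hC : C = 2 * k) (hb : 0 < b) (h0 : 0 < lam) (he : p = p') : m C b lam = 0 := by
  rw [m_eq_limsup hC hb h0]
  have h1 := ((continuous_compat k).tendsto p).comp (h.tendsto_of_eq he)
  have h2 := (h1.comp (tendsto_add_atTop_nat 1)).sub h1
  rw [sub_self] at h2
  exact h2.limsup_eq

/-- Along odd `n` the difference converges to the gap, and a limit along a subsequence is at most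
the limsup. -/
theorem IsExtremalPair.gap_le_m {p p' : Fin (C + 1) → ℝ} (h : IsExtremalPair b lam p p')
    (hC : C = 2 * k) (hb : 0 < b) (h0 : 0 < lam) : compat p k - compat p' k ≤ m C b lam := by
  rw [m_eq_limsup hC hb h0]
  set u : ℕ → ℝ := fun n => compat (iterLaw C b lam (n + 1)) k - compat (iterLaw C b lam n) k
  have hm := iterLaw_mem (C := C) (b := b) h0
  have hsub : Tendsto (fun n => u (2 * n + 1)) atTop (𝓝 (compat p k - compat p' k)) :=
    ((((continuous_compat k).tendsto p).comp h.even).comp (tendsto_add_atTop_nat 1)).sub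
      (((continuous_compat k).tendsto p').comp h.odd)
  have hφ : Tendsto (fun n : ℕ => 2 * n + 1) atTop atTop :=
    tendsto_atTop_mono (fun n => show n ≤ 2 * n + 1 by omega) tendsto_id
  have hbdd : IsBoundedUnder (· ≤ ·) atTop u := isBoundedUnder_of ⟨1, fun n => by
    have h1 := compat_le_one (hm (n + 1)) k
    have h2 := compat_nonneg (hm n).1 k
    simp only [u]
    linarith⟩
  rw [← hsub.limsup_eq]
  exact limsup_le_limsup_of_le (f := map (fun n : ℕ => 2 * n + 1) atTop) (u := u) hφ
    (IsBoundedUnder.isCoboundedUnder_le (l := map (fun n : ℕ => 2 * n + 1) atTop)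
      hsub.isBoundedUnder_ge) hbdd

theorem rootLaw_zero (h0 : 0 < lam) (n : ℕ) (i : Fin (C + 1)) :
    rootLaw C b lam 0 n i = iterLaw C b lam (2 * (n + 1)) i := by
  rw [rootLaw, ballProb_eq_sum h0 _ _ (fun j => j = i), fieldLaw_zero]
  simp [mul_add]

theorem rootLaw_last (hb : 0 < b) (h0 : 0 < lam) (n : ℕ) (i : Fin (C + 1)) :
    rootLaw C b lam (Fin.last C) n i = iterLaw C b lam (2 * n + 1) i := by
  rw [rootLaw, ballProb_eq_sum h0 _ _ (fun j => j = i), fieldLaw_last hb]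
  simp

theorem IsExtremalPair.tendsto_rootLaw_zero {p p' : Fin (C + 1) → ℝ}
    (h : IsExtremalPair b lam p p') (h0 : 0 < lam) (i : Fin (C + 1)) :
    Tendsto (fun n => rootLaw C b lam 0 n i) atTop (𝓝 (p i)) := by
  simp only [rootLaw_zero h0]
  exact (tendsto_pi_nhds.1 h.even i).comp (tendsto_add_atTop_nat 1)

theorem IsExtremalPair.tendsto_rootLaw_last {p p' : Fin (C + 1) → ℝ}
    (h : IsExtremalPair b lam p p') (hb : 0 < b) (h0 : 0 < lam) (i : Fin (C + 1)) :
    Tendsto (fun n => rootLaw C b lam (Fin.last C) n i) atTop (𝓝 (p' i)) := by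
  simp only [rootLaw_last hb h0]
  exact tendsto_pi_nhds.1 h.odd i

theorem IsExtremalPair.rootGap_eq {p p' : Fin (C + 1) → ℝ} (h : IsExtremalPair b lam p p')
    (hb : 0 < b) (h0 : 0 < lam) : rootGap C b lam = 1 / 2 * ∑ i, |p' i - p i| := by
  unfold rootGap limitRootLaw
  simp only [(h.tendsto_rootLaw_zero h0 _).limUnder_eq,
    (h.tendsto_rootLaw_last hb h0 _).limUnder_eq]

theorem IsExtremalPair.gap_le_rootGap {p p' : Fin (C + 1) → ℝ} (h : IsExtremalPair b lam p p')
    (hb : 0 < b) (h0 : 0 < lam) : (compat p k - compat p' k) / 2 ≤ rootGap C b lam := by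
  rw [h.rootGap_eq hb h0]
  have h1 : compat p k - compat p' k ≤ ∑ i, |p' i - p i| := by
    rw [compat, compat, ← Finset.sum_sub_distrib]
    refine Finset.sum_le_sum fun i _ => ?_
    split_ifs
    · rw [abs_sub_comm]
      exact le_abs_self _
    · simp
  linarith

/-! ### The critical activity and the jump -/

theorem le_rpow_window_iff (hC : C = 2 * k) (h0 : 0 ≤ lam) {x : ℝ} (hx : 0 ≤ x) :
    lam ≤ x ^ (2 / ((C : ℝ) + 2)) ↔ lam ^ (k + 1) ≤ x := by
  have : 2 / ((C : ℝ) + 2) = (((k + 1 : ℕ) : ℝ))⁻¹ := by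
    rw [hC]
    push_cast
    field_simp
  rw [this, Real.le_rpow_inv_iff_of_pos h0 hx (by positivity), Real.rpow_natCast]

/-- Whether the critical activity itself has coexistence is left open, so the large values may occur
at `x` or only at points decreasing to `x`. -/
theorem not_continuousAt_of_jump {f : ℝ → ℝ} {x c : ℝ} (hx : 0 < x) (hc : 0 < c)
    (hzero : ∀ y, 0 < y → y < x → f y = 0)
    (hjump : ∀ ε, 0 < ε → ∃ y, x ≤ y ∧ y < x + ε ∧ c ≤ f y) : ¬ ContinuousAt f x := by
  intro hf
  have h1 : Tendsto f (𝓝[<] x) (𝓝 0) := by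
    refine tendsto_const_nhds.congr' ?_
    filter_upwards [Ioo_mem_nhdsLT hx] with y hy
    exact (hzero y hy.1 hy.2).symm
  have h2 : f x = 0 := tendsto_nhds_unique (hf.tendsto.mono_left nhdsWithin_le_nhds) h1
  have h3 : ∀ᶠ y in 𝓝 x, f y < c := hf.eventually_lt_const (by rw [h2]; exact hc)
  obtain ⟨ε, hε, h4⟩ := Metric.eventually_nhds_iff.1 h3
  obtain ⟨y, hy1, hy2, hy3⟩ := hjump ε hε
  have h5 : dist y x < ε := by
    rw [Real.dist_eq, abs_of_nonneg (by linarith)]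
    linarith
  exact absurd (h4 h5) (not_lt.2 hy3)

theorem gibbsUnique_or_phaseCoexistence (C : ℕ) (hb : 0 < b) (h0 : 0 < lam) :
    GibbsUnique C b lam ∨ PhaseCoexistence C b lam := by
  obtain ⟨p, p', h⟩ := exists_isExtremalPair C b h0
  by_cases he : p = p'
  · exact Or.inl (gibbsUnique_of_eq h0 hb h he)
  · exact Or.inr (phaseCoexistence_of_ne h0 h he)

theorem GibbsUnique.not_phaseCoexistence (h : GibbsUnique C b lam) : ¬ PhaseCoexistence C b lam :=
  fun ⟨_, _, hμ, hν, hne⟩ => hne (h.unique hμ hν)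

/-- The infimum of the activities with phase coexistence. -/
theorem exists_critical (hL : LargeDegree k b) (hk : 1 ≤ k) (hC : C = 2 * k) :
    ∃ lc : ℝ, (Real.log b / (((C : ℝ) + 2) * b)) ^ (2 / ((C : ℝ) + 2)) ≤ lc ∧
      lc ≤ (Real.log b / b) ^ (2 / ((C : ℝ) + 2)) ∧
      (∀ lam : ℝ, 0 < lam → lam < lc → GibbsUnique C b lam) ∧
      IsGLB {lam : ℝ | 0 < lam ∧ PhaseCoexistence C b lam} lc ∧
      ¬ ContinuousAt (m C b) lc ∧ ¬ ContinuousAt (rootGap C b) lc := by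
  have hb := hL.cast_pos
  have hbn : 0 < b := by exact_mod_cast hb
  have hlog : 0 < Real.log b := by linarith [hL.one_le_log]
  set S : Set ℝ := {lam : ℝ | 0 < lam ∧ PhaseCoexistence C b lam}
  set lo := (Real.log b / (((C : ℝ) + 2) * b)) ^ (2 / ((C : ℝ) + 2)) with hlo
  set hi := (Real.log b / b) ^ (2 / ((C : ℝ) + 2)) with hhi
  have hlo0 : 0 < lo := by positivity
  have hhi0 : 0 < hi := by positivity
  have hlow : ∀ x ∈ S, lo ≤ x := by
    rintro x ⟨hx0, hx⟩
    by_contra! hlt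
    obtain ⟨p, p', h⟩ := exists_isExtremalPair C b hx0
    refine (phaseCoexistence_iff hx0 hbn h).1 hx (h.eq_of_lt_window hL hx0 hC ?_)
    have h1 := (le_rpow_window_iff hC hx0.le (by positivity)).1 hlt.le
    have h2 : Real.log b / (((C : ℝ) + 2) * b) = Real.log b / (2 * (k + 1)) / b := by
      rw [hC, div_div]
      push_cast
      ring
    rw [h2, le_div_iff₀ hb] at h1
    linarith
  have hhiS : hi ∈ S := by
    obtain ⟨p, p', h⟩ := exists_isExtremalPair C b hhi0
    refine ⟨hhi0, phaseCoexistence_of_ne hhi0 h (h.ne_of_log_eq hL hhi0 hk hC ?_)⟩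
    have h1 : hi ^ (k + 1) = Real.log b / b := by
      rw [hhi, ← Real.rpow_natCast, ← Real.rpow_mul (by positivity)]
      have : 2 / ((C : ℝ) + 2) * ((k + 1 : ℕ) : ℝ) = 1 := by
        rw [hC]
        push_cast
        field_simp
      rw [this, Real.rpow_one]
    rw [h1]
    field_simp
  have hbdd : BddBelow S := ⟨lo, hlow⟩
  have hne : S.Nonempty := ⟨hi, hhiS⟩
  have hglb := isGLB_csInf hne hbdd
  have hlolc : lo ≤ sInf S := le_csInf hne hlow
  have hlc0 : 0 < sInf S := hlo0.trans_le hlolc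
  have hlchi : sInf S ≤ hi := csInf_le hbdd hhiS
  have huniq : ∀ lam : ℝ, 0 < lam → lam < sInf S → GibbsUnique C b lam := by
    intro lam h0 hlt
    refine (gibbsUnique_or_phaseCoexistence C hbn h0).resolve_right fun hco => ?_
    exact absurd (csInf_le hbdd ⟨h0, hco⟩) (not_le.2 hlt)
  have heq : ∀ lam : ℝ, 0 < lam → lam < sInf S → ∀ p p' : Fin (C + 1) → ℝ,
      IsExtremalPair b lam p p' → p = p' := by
    intro lam h0 hlt p p' h
    by_contra hne
    exact (huniq lam h0 hlt).not_phaseCoexistence (phaseCoexistence_of_ne h0 h hne)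
  have hgap : ∀ ε, 0 < ε → ∃ y, sInf S ≤ y ∧ y < sInf S + ε ∧ 0 < y ∧
      ∃ p p' : Fin (C + 1) → ℝ, IsExtremalPair b y p p' ∧
        1 / (2 * b) ≤ compat p k - compat p' k := by
    intro ε hε
    -- The infimum might equal `hi`, so coexistence points near it may lie above `hi`. The dichotomy
    -- still reaches them because its range extends to `3 * log b / b`.
    set top := (3 * Real.log b / b) ^ (2 / ((C : ℝ) + 2))
    have hlt : hi < top := by
      refine Real.rpow_lt_rpow (by positivity) ?_ (by positivity)
      gcongr
      linarith
    obtain ⟨y, ⟨hy0, hyc⟩, hylt⟩ := exists_lt_of_csInf_lt hne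
      (show sInf S < min (sInf S + ε) top from lt_min (by linarith) (hlchi.trans_lt hlt))
    obtain ⟨p, p', h⟩ := exists_isExtremalPair C b hy0
    refine ⟨y, csInf_le hbdd ⟨hy0, hyc⟩, hylt.trans_le (min_le_left _ _), hy0, p, p', h, ?_⟩
    have h1 := (le_rpow_window_iff hC hy0.le (by positivity)).1
      (hylt.trans_le (min_le_right _ _)).le
    rw [le_div_iff₀ hb] at h1
    have h2 := (h.eq_or_lt_gap hL hy0 hC (by linarith)).resolve_left
      ((phaseCoexistence_iff hy0 hbn h).1 hyc)
    have h3 := hL.exp_le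
    have h4 : 1 / (b : ℝ) = 1 / (2 * b) + 1 / (2 * b) := by
      field_simp
      norm_num
    linarith
  refine ⟨sInf S, hlolc, hlchi, huniq, hglb, ?_, ?_⟩
  · refine not_continuousAt_of_jump hlc0 (c := 1 / (2 * b)) (by positivity) (fun y hy hylt => ?_)
      fun ε hε => ?_
    · obtain ⟨p, p', h⟩ := exists_isExtremalPair C b hy
      exact h.m_eq_zero hC hbn hy (heq y hy hylt p p' h)
    · obtain ⟨y, h1, h2, hy0, p, p', h, h3⟩ := hgap ε hε
      exact ⟨y, h1, h2, h3.trans (h.gap_le_m hC hbn hy0)⟩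
  · refine not_continuousAt_of_jump hlc0 (c := 1 / (2 * b) / 2) (by positivity)
      (fun y hy hylt => ?_) fun ε hε => ?_
    · obtain ⟨p, p', h⟩ := exists_isExtremalPair C b hy
      rw [h.rootGap_eq hbn hy, heq y hy hylt p p' h]
      simp
    · obtain ⟨y, h1, h2, hy0, p, p', h, h3⟩ := hgap ε hε
      exact ⟨y, h1, h2, le_trans (by linarith) (h.gap_le_rootGap (k := k) hbn hy0)⟩

end MultiStateHardCore

/-! ### Assembly of the theorem -/

theorem mainTheorem5 (C : ℕ) (hC : Even C) (hC0 : 0 < C) :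
    ∃ (c₁ c₂ α : ℝ) (b₀ : ℕ), 0 < c₁ ∧ 0 < c₂ ∧ 0 < α ∧ 2 ≤ b₀ ∧ ∀ b : ℕ, b₀ ≤ b →
      -- the root marginals with empty and with full boundary condition converge
      (∀ lam : ℝ, 0 < lam → ∀ i : Fin (C + 1), ∀ a ∈ ({0, Fin.last C} : Set (Fin (C + 1))),
        Filter.Tendsto (fun n : ℕ => MultiStateHardCore.rootLaw C b lam a n i) Filter.atTop
          (nhds (MultiStateHardCore.limitRootLaw C b lam a i))) ∧
      -- the dichotomy for `m`
      (∀ lam : ℝ, 0 < lam → lam ≤ (3 * Real.log b / b) ^ (2 / ((C : ℝ) + 2)) →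
        ∀ δ : ℝ, 0 < δ → δ < 1 →
          MultiStateHardCore.m C b lam = 0 ∨
            δ / b - c₁ * Real.exp (-c₂ * (b : ℝ) ^ α) ≤ MultiStateHardCore.m C b lam) ∧
      -- uniqueness is first lost inside the window, with a jump
      (∃ lc : ℝ,
        (Real.log b / (((C : ℝ) + 2) * b)) ^ (2 / ((C : ℝ) + 2)) ≤ lc ∧
        lc ≤ (Real.log b / b) ^ (2 / ((C : ℝ) + 2)) ∧
        (∀ lam : ℝ, 0 < lam → lam < lc → MultiStateHardCore.GibbsUnique C b lam) ∧
        IsGLB {lam : ℝ | 0 < lam ∧ MultiStateHardCore.PhaseCoexistence C b lam} lc ∧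
        ¬ ContinuousAt (MultiStateHardCore.m C b) lc ∧
        ¬ ContinuousAt (MultiStateHardCore.rootGap C b) lc) ∧
      -- a critical value, if there is one, is a first-order transition
      (∀ lc : ℝ, MultiStateHardCore.IsPhaseTransitionAt C b lc →
        MultiStateHardCore.IsFirstOrderAt C b lc) := by

  obtain ⟨k, rfl⟩ := hC.two_dvd
  have hk : 1 ≤ k := by omega
  obtain ⟨N, hN⟩ := eventually_atTop.1 (MultiStateHardCore.eventually_largeDegree k)
  refine ⟨1, 1 / 800, MultiStateHardCore.rate k, max 2 N, one_pos, by norm_num,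
    MultiStateHardCore.rate_pos k, le_max_left _ _, fun b hb => ?_⟩
  have hL := hN b ((le_max_right _ _).trans hb)
  have hbn : 0 < b := by exact_mod_cast hL.cast_pos
  have hlog : 0 < Real.log b := by linarith [hL.one_le_log]
  obtain ⟨lc, h1, h2, h3, h4, h5, h6⟩ := MultiStateHardCore.exists_critical hL hk rfl
  refine ⟨fun lam h0 i a ha => ?_, fun lam h0 hlam δ _ hδ => ?_, ⟨lc, h1, h2, h3, h4, h5, h6⟩,
    fun lcr hcr => ⟨hcr, ?_⟩⟩
  · obtain ⟨p, p', h⟩ := MultiStateHardCore.exists_isExtremalPair (2 * k) b h0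
    rcases ha with rfl | rfl
    · have := h.tendsto_rootLaw_zero h0 i
      rwa [← this.limUnder_eq] at this
    · have := h.tendsto_rootLaw_last hbn h0 i
      rwa [← this.limUnder_eq] at this
  · obtain ⟨p, p', h⟩ := MultiStateHardCore.exists_isExtremalPair (2 * k) b h0
    have hl := (MultiStateHardCore.le_rpow_window_iff rfl h0.le (by positivity)).1 hlam
    rw [le_div_iff₀ hL.cast_pos, mul_comm] at hl
    refine (h.eq_or_lt_gap hL h0 rfl hl).imp (h.m_eq_zero rfl hbn h0) fun hgap => ?_
    have hm := h.gap_le_m rfl hbn h0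
    have hδb : δ / b ≤ 1 / b := by gcongr
    have he : -((b : ℝ) ^ MultiStateHardCore.rate k / 800)
        = -(1 / 800) * (b : ℝ) ^ MultiStateHardCore.rate k := by ring
    rw [he] at hgap
    linarith
  -- Uniqueness below and coexistence above force any transition point to be the infimum of the
  -- coexistence set, where the jump is known.
  · have hlc : lcr = lc := by
      refine le_antisymm (h4.2 fun x hx => ?_) ?_
      · by_contra! hlt
        exact (hcr.2.1 x hx.1 hlt).not_phaseCoexistence hx.2
      · by_contra! hlt
        have hx : 0 < (lcr + lc) / 2 := by linarith [hcr.1]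
        exact (h3 _ hx (by linarith)).not_phaseCoexistence (hcr.2.2 _ (by linarith))
    rw [hlc]
    exact h6
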